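/- All representations are over $\mathbb{C}$. For a partition $\lambda\vdash b$ let $S^\lambda$ be the Specht module of the symmetric group $S_b$, i.e. the span of the polytabloids $e_t$ ($t$ a $\lambda$-tableau) in the permutation module on $\lambda$-tabloids. For integers $c,b\ge 0$ the wreath product $S_c\wr S_b=(S_c)^b\rtimes S_b$ permutes $b$ blocks of size $c$, which gives a homomorphism $S_c\wr S_b\to S_{cb}$ (an embedding if $c\ge1$), and the generalized Foulkes module is the induced module $F_\lambda^{c}=\mathbb{C}S_{cb}\otimes_{\mathbb{C}[S_c\wr S_b]}\operatorname{Inf}_{S_b}^{S_c\wr S_b}S^\lambda$, where the inflation is along the projection $S_c\wr S_b\to S_b$; for $\lambda=(b)$ it is the ordinary Foulkes module. Let $X^0$ be the standard ordered partition of $\{1,\dots,cb\}$ into $b$ blocks of size $c$; for an ordered partition $X=gX^0$ ($g\in S_{cb}$) into $b$ blocks of size $c$ and a $\lambda$-tableau $t$ put $e_{t_X}=g\otimes e_t\in F_\lambda^{c}$. Let $a\ge 1$ and $b\ge 0$ be integers and $n=ab$. The $(1^b)$-summand $U_{\lambda,a}$ of the restriction of $F_\lambda^a$ to $S_b\times S_{n-b}$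 (acting on $\{1,\dots,b\}$ and $\{b+1,\dots,n\}$) is the submodule spanned by all $e_{t_X}$ such that every block of $X$ contains exactly one element of $\{1,\dots,b\}$. Then, as $S_b\times S_{n-b}$-modules, $$U_{(b),a}\;\cong\;\bigoplus_{\lambda\vdash b} S^\lambda\otimes F_\lambda^{a-1},$$ where $\otimes$ is the external tensor product. In particular, for $a=2$, as $S_b\times S_b$-modules, $$U_{(b),2}\;\cong\;\bigoplus_{\lambda\vdash b} S^\lambda\otimes S^\lambda .$$ -/

import Mathlib

open scoped MonoidAlgebra DirectSum TensorProduct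

noncomputable section

namespace Foulkes

/-! ### Specht modules -/

/-- The Young diagram of a partition `ν` of `b`: rows of lengths `ν₁ ≥ ν₂ ≥ …`. -/
def shape {b : ℕ} (ν : Nat.Partition b) : YoungDiagram :=
  YoungDiagram.ofRowLens (ν.parts.sort (· ≥ ·)) (Multiset.pairwise_sort ν.parts (· ≥ ·)).sortedGE

/-- A `ν`-tableau: a bijective filling of the cells `(row, column)` of `ν` by the letters. -/
def Tableau {b : ℕ} (ν : Nat.Partition b) : Type :=
  {c : ℕ × ℕ // c ∈ (shape ν).cells} ≃ Fin b

namespace Tableau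

variable {b : ℕ} {ν : Nat.Partition b}

/-- The row of `t` that contains the letter `x`. -/
def row (t : Tableau ν) (x : Fin b) : ℕ := (t.symm x).1.1

/-- The column of `t` that contains the letter `x`. -/
def col (t : Tableau ν) (x : Fin b) : ℕ := (t.symm x).1.2

/-- Permutations act on tableaux by permuting the letters. -/
instance : MulAction (Equiv.Perm (Fin b)) (Tableau ν) where
  smul σ t := Equiv.trans t σ
  one_smul _ := rfl
  mul_smul _ _ _ := rfl

theorem row_smul (σ : Equiv.Perm (Fin b)) (t : Tableau ν) (x : Fin b) :
    (σ • t).row x = t.row (σ⁻¹ x) := rfl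

theorem col_smul (σ : Equiv.Perm (Fin b)) (t : Tableau ν) (x : Fin b) :
    (σ • t).col x = t.col (σ⁻¹ x) := rfl

/-- Row equivalence: each letter lies in the same row of the two tableaux. -/
def rowSetoid (ν : Nat.Partition b) : Setoid (Tableau ν) where
  r s t := ∀ x, s.row x = t.row x
  iseqv := ⟨fun _ _ => rfl, fun h x => (h x).symm, fun h k x => (h x).trans (k x)⟩

end Tableau

/-- A `ν`-tabloid: a row equivalence class of `ν`-tableaux. -/
def Tabloid {b : ℕ} (ν : Nat.Partition b) : Type := Quotient (Tableau.rowSetoid ν)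

section Specht

variable {b : ℕ} {ν : Nat.Partition b}

/-- The tabloid `{t}` of a tableau `t`. -/
def Tableau.tabloid (t : Tableau ν) : Tabloid ν := Quotient.mk (Tableau.rowSetoid ν) t

/-- The action of permutations on tabloids, `σ{t} = {σt}`. -/
instance : MulAction (Equiv.Perm (Fin b)) (Tabloid ν) where
  smul σ := Quotient.map (sa := Tableau.rowSetoid ν) (sb := Tableau.rowSetoid ν) (σ • ·)
    (fun _ _ h x => h (σ⁻¹ x))
  one_smul T := Quotient.inductionOn (s := Tableau.rowSetoid ν) T fun _ => rfl
  mul_smul _ _ T := Quotient.inductionOn (s := Tableau.rowSetoid ν) T fun _ => rfl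

theorem Tableau.smul_tabloid (σ : Equiv.Perm (Fin b)) (t : Tableau ν) :
    σ • t.tabloid = (σ • t).tabloid := rfl

open Classical in
/-- The polytabloid `e_t = ∑ sgn(π) {πt}`, over the `π` that preserve every column of `t`. -/
def polytabloid (t : Tableau ν) : ℂ[Tabloid ν] :=
  ∑ π : Equiv.Perm (Fin b) with ∀ x, t.col (π x) = t.col x,
    MonoidAlgebra.single (π • t).tabloid ((Equiv.Perm.sign π : ℤ) : ℂ)

theorem ofMulAction_polytabloid (σ : Equiv.Perm (Fin b)) (t : Tableau ν) :
    Representation.ofMulAction ℂ (Equiv.Perm (Fin b)) (Tabloid ν) σ (polytabloid t) =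
      polytabloid (σ • t) := by
  classical
  simp only [polytabloid, map_sum, Representation.ofMulAction_single]
  refine Finset.sum_bij' (fun π _ => σ * π * σ⁻¹) (fun π _ => σ⁻¹ * π * σ) ?_ ?_ ?_ ?_ ?_
  · intro π h
    refine Finset.mem_filter.2 ⟨Finset.mem_univ _, fun x => ?_⟩
    simpa [Tableau.col_smul] using (Finset.mem_filter.1 h).2 (σ⁻¹ x)
  · intro π h
    refine Finset.mem_filter.2 ⟨Finset.mem_univ _, fun x => ?_⟩
    simpa [Tableau.col_smul] using (Finset.mem_filter.1 h).2 (σ x)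
  · intro π _; group
  · intro π _; group
  · intro π _
    have hs : Equiv.Perm.sign (σ * π * σ⁻¹) = Equiv.Perm.sign π := by
      rw [map_mul, map_mul, map_inv, mul_right_comm, mul_inv_cancel, one_mul]
    rw [Tableau.smul_tabloid, hs, smul_smul, smul_smul, inv_mul_cancel_right]

/-- The Specht module `S^ν`: the span of the polytabloids in the permutation module on
tabloids, as a subrepresentation. -/
def spechtSub (ν : Nat.Partition b) :
    Subrepresentation (Representation.ofMulAction ℂ (Equiv.Perm (Fin b)) (Tabloid ν)) where
  toSubmodule := Submodule.span ℂ (Set.range polytabloid)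
  apply_mem_toSubmodule σ v hv := by
    induction hv using Submodule.span_induction with
    | mem v hv =>
      obtain ⟨t, rfl⟩ := hv
      rw [ofMulAction_polytabloid]
      exact Submodule.subset_span ⟨_, rfl⟩
    | zero => simp
    | add v w _ _ hv hw => rw [map_add]; exact Submodule.add_mem _ hv hw
    | smul c v _ hv => rw [map_smul]; exact Submodule.smul_mem _ _ hv

/-- The Specht module `S^ν` as a complex representation of the symmetric group. -/
def specht (ν : Nat.Partition b) :
    Representation ℂ (Equiv.Perm (Fin b)) (spechtSub ν).toSubmodule :=
  (spechtSub ν).toRepresentation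

/-- The polytabloid `e_t` as an element of the Specht module. -/
def spechtVec (t : Tableau ν) : (spechtSub ν).toSubmodule :=
  ⟨polytabloid t, Submodule.subset_span ⟨t, rfl⟩⟩

theorem specht_spechtVec (σ : Equiv.Perm (Fin b)) (t : Tableau ν) :
    specht ν σ (spechtVec t) = spechtVec (σ • t) :=
  Subtype.ext (ofMulAction_polytabloid σ t)

end Specht

/-! ### Generalized Foulkes modules -/

/-- The wreath product of `S_a` with `S_b`: the semidirect product `S_a ^ b ⋊ S_b`,
where `S_b` permutes the `b` factors. -/
abbrev Wreath (a b : ℕ) : Type :=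
  (Fin b → Equiv.Perm (Fin a)) ⋊[mulAutArrow] Equiv.Perm (Fin b)

/-- The action of the wreath product on `b` blocks of size `a`, the pair `(x, i)` being
the element number `x` of the block number `i`. -/
def wreathPerm (a b : ℕ) : Wreath a b →* Equiv.Perm (Fin a × Fin b) where
  toFun w :=
    { toFun := fun p => (w.left (w.right p.2) p.1, w.right p.2)
      invFun := fun p => ((w.left p.2)⁻¹ p.1, w.right⁻¹ p.2)
      left_inv := fun p => by simp
      right_inv := fun p => by simp }
  map_one' := by ext p <;> simp
  map_mul' w w' := by
    ext p
    · have h : ((mulAutArrow w.right) w'.left) (w.right (w'.right p.2)) =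
          w'.left (w'.right p.2) := by
        change w'.left (w.right⁻¹ (w.right (w'.right p.2))) = _
        simp
      simp only [SemidirectProduct.mul_left, SemidirectProduct.mul_right, Pi.mul_apply,
        Equiv.Perm.mul_apply, Equiv.coe_fn_mk, h]
    · simp

/-- The identification of `b` blocks of size `a` with the standard `ab`-element set. -/
def blockEquiv (a b : ℕ) : Fin a × Fin b ≃ Fin (a * b) := finProdFinEquiv

/-- The homomorphism from the wreath product to `S_{ab}` (an embedding if `a ≥ 1`). -/
def wreathHom (a b : ℕ) : Wreath a b →* Equiv.Perm (Fin (a * b)) :=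
  (blockEquiv a b).permCongrHom.toMonoidHom.comp (wreathPerm a b)

variable {b : ℕ}

/-- The inflation of the Specht module `S^ν` along the wreath product's projection to `S_b`. -/
def inflSpecht (a : ℕ) (ν : Nat.Partition b) :
    Representation ℂ (Wreath a b) (spechtSub ν).toSubmodule :=
  (specht ν).comp SemidirectProduct.rightHom

/-- The underlying space of the generalized Foulkes module `F_ν^a`. -/
abbrev FoulkesV (a : ℕ) (ν : Nat.Partition b) : Type :=
  Representation.IndV (wreathHom a b) (inflSpecht a ν)

/-- The generalized Foulkes module `F_ν^a`: the inflation of `S^ν` to the wreath product,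
induced to `S_{ab}`. -/
def foulkes (a : ℕ) (ν : Nat.Partition b) :
    Representation ℂ (Equiv.Perm (Fin (a * b))) (FoulkesV a ν) :=
  Representation.ind (wreathHom a b) (inflSpecht a ν)

/-- The block number `i` of the ordered set partition of the `ab`-element set into `b` blocks
of size `a` that is the image under `g` of the standard one. Every such ordered set partition
arises from some `g`. -/
def block (a : ℕ) (g : Equiv.Perm (Fin (a * b))) (i : Fin b) : Finset (Fin (a * b)) :=
  Finset.univ.image fun x : Fin a => g (blockEquiv a b (x, i))

/-- The vector `e_{t_X}` of `F_ν^a`, where `X` is the image under `g` of the standard ordered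
set partition: it is `g ⊗ e_t`. (In `Representation.ind` the class of `h ⊗ v` is what is
usually written `h⁻¹ ⊗ v`.) It depends on `g` only through `X`. -/
def foulkesVec (a : ℕ) (ν : Nat.Partition b) (g : Equiv.Perm (Fin (a * b))) (t : Tableau ν) :
    FoulkesV a ν :=
  Representation.IndV.mk (wreathHom a b) (inflSpecht a ν) g⁻¹ (spechtVec t)

theorem foulkes_foulkesVec (a : ℕ) (ν : Nat.Partition b) (σ g : Equiv.Perm (Fin (a * b)))
    (t : Tableau ν) : foulkes a ν σ (foulkesVec a ν g t) = foulkesVec a ν (σ * g) t := by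
  unfold foulkes foulkesVec
  rw [Representation.ind_mk, mul_inv_rev]

/-! ### Restriction to `S_k × S_m` and its components -/

/-- The embedding of `S_k × S_m` in `S_n`, where `n = k + m`: the first factor permutes the
first `k` letters, the second one the last `m` letters. -/
def youngHom {k m n : ℕ} (h : k + m = n) :
    Equiv.Perm (Fin k) × Equiv.Perm (Fin m) →* Equiv.Perm (Fin n) :=
  (finSumFinEquiv.trans (finCongr h)).permCongrHom.toMonoidHom.comp
    (Equiv.Perm.sumCongrHom (Fin k) (Fin m))

/-- The first `k` letters. -/
def initial (k n : ℕ) : Finset (Fin n) := Finset.univ.filter fun x => x.1 < k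

theorem youngHom_mem_initial {k m n : ℕ} (h : k + m = n)
    (p : Equiv.Perm (Fin k) × Equiv.Perm (Fin m)) (x : Fin n) :
    youngHom h p x ∈ initial k n ↔ x ∈ initial k n := by
  obtain ⟨y, rfl⟩ := (finSumFinEquiv.trans (finCongr h)).surjective x
  cases y <;> simp [initial, youngHom]

/-- The partition type of the trace of `X` on the first `k` letters (`X` the image under `g` of
the standard ordered set partition), as a multiset: the non-zero ones among the sizes of the
intersections of the blocks with the first `k` letters. -/
def traceType (a k : ℕ) (g : Equiv.Perm (Fin (a * b))) : Multiset ℕ :=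
  (Finset.univ.val.map fun i : Fin b => (block a g i ∩ initial k (a * b)).card).filter (· ≠ 0)

theorem traceType_youngHom {a k m : ℕ} (h : k + m = a * b)
    (p : Equiv.Perm (Fin k) × Equiv.Perm (Fin m)) (g : Equiv.Perm (Fin (a * b))) :
    traceType a k (youngHom h p * g) = traceType a k g := by
  unfold traceType
  congr 2
  funext i
  have : block a (youngHom h p * g) i ∩ initial k (a * b) =
      (block a g i ∩ initial k (a * b)).image (youngHom h p) := by
    ext y
    simp only [block, Finset.mem_inter, Finset.mem_image, Finset.mem_univ, true_and,
      Equiv.Perm.mul_apply]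
    constructor
    · rintro ⟨⟨x, rfl⟩, hy⟩
      exact ⟨_, ⟨⟨x, rfl⟩, (youngHom_mem_initial h p _).1 hy⟩, rfl⟩
    · rintro ⟨_, ⟨⟨x, rfl⟩, hy⟩, rfl⟩
      exact ⟨⟨x, rfl⟩, (youngHom_mem_initial h p _).2 hy⟩
  rw [this, Finset.card_image_of_injective _ (youngHom h p).injective]

/-- The restriction of `F_ν^a` to `S_k × S_m`, where `k + m = ab`. -/
def foulkesRes {a k m : ℕ} (h : k + m = a * b) (ν : Nat.Partition b) :
    Representation ℂ (Equiv.Perm (Fin k) × Equiv.Perm (Fin m)) (FoulkesV a ν) :=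
  (foulkes a ν).comp (youngHom h)

/-- The `μ`-component `V_{ν,a}^μ` of the restriction of `F_ν^a` to `S_k × S_m`: the span of the
vectors `e_{t_X}` such that the trace of `X` on the first `k` letters has type `μ`. -/
def component {a k m : ℕ} (h : k + m = a * b) (ν : Nat.Partition b) (μ : Nat.Partition k) :
    Subrepresentation (foulkesRes h ν) where
  toSubmodule := Submodule.span ℂ
    {v | ∃ (g : Equiv.Perm (Fin (a * b))) (t : Tableau ν),
      traceType a k g = μ.parts ∧ v = foulkesVec a ν g t}
  apply_mem_toSubmodule p v hv := by
    induction hv using Submodule.span_induction with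
    | mem v hv =>
      obtain ⟨g, t, hg, rfl⟩ := hv
      refine Submodule.subset_span ⟨youngHom h p * g, t, ?_, ?_⟩
      · rw [traceType_youngHom, hg]
      · exact foulkes_foulkesVec a ν _ g t
    | zero => simp
    | add v w _ _ hv hw => rw [map_add]; exact Submodule.add_mem _ hv hw
    | smul c v _ hv => rw [map_smul]; exact Submodule.smul_mem _ _ hv

/-- The partition `(1^b)` of `b`. -/
def ones (b : ℕ) : Nat.Partition b where
  parts := Multiset.replicate b 1
  parts_pos h := by rw [Multiset.eq_of_mem_replicate h]; exact one_pos
  parts_sum := by simp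

/-- The `(1^b)`-summand `U_{ν,a}` of the restriction of `F_ν^a` to `S_b × S_m`, `m = ab - b`. -/
def U {a m : ℕ} (h : b + m = a * b) (ν : Nat.Partition b) :
    Representation ℂ (Equiv.Perm (Fin b) × Equiv.Perm (Fin m))
      (component h ν (ones b)).toSubmodule :=
  (component h ν (ones b)).toRepresentation

/-- The external tensor product of a representation of `G` and a representation of `H`,
a representation of `G × H`. -/
def extTensor {G H V W : Type} [Group G] [Group H] [AddCommGroup V] [Module ℂ V]
    [AddCommGroup W] [Module ℂ W] (ρ : Representation ℂ G V) (τ : Representation ℂ H W) :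
    Representation ℂ (G × H) (V ⊗[ℂ] W) :=
  Representation.tprod (ρ.comp (MonoidHom.fst G H)) (τ.comp (MonoidHom.snd G H))

theorem add_pred_mul {a : ℕ} (ha : 1 ≤ a) (b : ℕ) : b + (a - 1) * b = a * b := by
  obtain ⟨c, rfl⟩ := Nat.exists_eq_add_of_le ha
  rw [Nat.add_sub_cancel_left, add_mul, one_mul]

end Foulkes

end

/-! Write a = c + 1 and m = cb. The space U_{(b),a} is spanned by the set partitions of the n
letters with exactly one of the first b letters, the mark, in each block. The group S_b × S_m
permutes these transitively. The stabilizer of the standard one is the image of the wreath product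
S_c ≀ S_b under w ↦ (projection of w to S_b, action of w on the m unmarked letters). So U_{(b),a} is
the permutation module on the cosets of this image, that is, ℂ[S_b] ⊗ ℂ[S_m] modulo right
translation by S_c ≀ S_b.

As a bimodule ℂ[S_b] is the sum of the S^λ ⊗ S^λ. The left factor keeps the action of S_b. The right
factor is consumed by the quotient, which turns S^λ ⊗ ℂ[S_m] into the induced module F_λ^c.
`regularEquiv` gives the bimodule decomposition; `exists_youngHom_mul_markPerm`,
`exists_wreath_of_youngHom_mul_markPerm` and `exists_eq_youngHom_mul_markPerm` give the stabilizer
and transitivity; `summandEquiv` combines them.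

The decomposition of ℂ[S_b] is obtained without irreducibility or Maschke's theorem. The Fourier
transform into the product of the End(S^λ) is onto because signed column sums act triangularly
(`fourier_specht_surjective`). It is then injective because S_b has no more conjugacy classes than b
has partitions (`fourier_injective`). The invariant form identifies End(S^λ) with S^λ ⊗ S^λ
(`spechtEnd`).

For a = 2 the blocks of unmarked letters have size one, and induction along the surjection S_1 ≀ S_b
→ S_b undoes inflation. -/

noncomputable section

namespace Foulkes

/-! ### The Fourier transform of a finite group -/

section Fourier

variable {G : Type*} [Group G] [Fintype G] {ι : Type*} {V : ι → Type*}
  [∀ i, AddCommGroup (V i)] [∀ i, Module ℂ (V i)] (ρ : ∀ i, Representation ℂ G (V i))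

/-- The Fourier transform of a finite group with respect to a family of representations. -/
def fourier : (G → ℂ) →ₗ[ℂ] ∀ i, Module.End ℂ (V i) :=
  LinearMap.pi fun i => ∑ g, (LinearMap.proj g).smulRight (ρ i g)

theorem fourier_apply (x : G → ℂ) (i : ι) : fourier ρ x i = ∑ g, x g • ρ i g := by
  simp [fourier, LinearMap.sum_apply]

theorem fourier_translate (x : G → ℂ) (g h : G) (i : ι) :
    fourier ρ (fun k => x (g⁻¹ * k * h)) i = ρ i g * fourier ρ x i * ρ i h⁻¹ := by
  simp only [fourier_apply, Finset.mul_sum, Finset.sum_mul]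
  refine Fintype.sum_equiv ((Equiv.mulLeft g⁻¹).trans (Equiv.mulRight h)) _ _ fun k => ?_
  simp only [Equiv.trans_apply, Equiv.coe_mulLeft, Equiv.coe_mulRight, mul_smul_comm,
    smul_mul_assoc, ← map_mul]
  congr 2
  group

/-- The sum of the conjugates of a function on a finite group. -/
def conjSum (x : G → ℂ) (h : G) : ℂ := ∑ g, x (g⁻¹ * h * g)

theorem conjSum_conj (x : G → ℂ) (g h : G) : conjSum x (g * h * g⁻¹) = conjSum x h := by
  unfold conjSum
  refine Fintype.sum_equiv (Equiv.mulLeft g⁻¹) _ _ fun k => ?_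
  simp only [Equiv.coe_mulLeft]
  congr 1
  group

theorem exists_conjSum_eq (x : G → ℂ) :
    ∃ f : ConjClasses G → ℂ, conjSum x = f ∘ ConjClasses.mk := by
  refine ⟨Quotient.lift (conjSum x) fun g h hgh => ?_, rfl⟩
  obtain ⟨k, rfl⟩ := isConj_iff.1 hgh
  exact (conjSum_conj x k g).symm

theorem fourier_conjSum (x : G → ℂ) (i : ι) :
    fourier ρ (conjSum x) i = ∑ g, ρ i g * fourier ρ x i * ρ i g⁻¹ := by
  have : conjSum x = ∑ g, fun h => x (g⁻¹ * h * g) := by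
    ext h; simp [conjSum]
  rw [this, map_sum, Finset.sum_apply]
  exact Finset.sum_congr rfl fun g _ => fourier_translate ρ x g g i

/-- The traces of Fourier transforms map class functions onto ℂ^ι, and the bound on conjugacy
classes makes this map injective. A nonzero kernel element could be translated to be nonzero at the
identity; the sum of its conjugates would be a nonzero class function killed by all these traces. -/
theorem fourier_injective [Fintype ι] [∀ i, Module.Finite ℂ (V i)] [∀ i, Nontrivial (V i)]
    (hcard : Nat.card (ConjClasses G) ≤ Fintype.card ι) (hsurj : Function.Surjective (fourier ρ)) :
    Function.Injective (fourier ρ) := by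
  classical
  have : Fintype (ConjClasses G) := Fintype.ofFinite _
  let χ : (ConjClasses G → ℂ) →ₗ[ℂ] (ι → ℂ) := LinearMap.pi fun i =>
    LinearMap.trace ℂ (V i) ∘ₗ LinearMap.proj i ∘ₗ fourier ρ ∘ₗ
      LinearMap.funLeft ℂ ℂ ConjClasses.mk
  have hχ : ∀ f i, χ f i = LinearMap.trace ℂ (V i) (fourier ρ (f ∘ ConjClasses.mk) i) :=
    fun _ _ => rfl
  have hG : (Fintype.card G : ℂ) ≠ 0 := Nat.cast_ne_zero.2 Fintype.card_ne_zero
  have hdim : ∀ i, (Module.finrank ℂ (V i) : ℂ) ≠ 0 := fun i =>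
    Nat.cast_ne_zero.2 (Module.finrank_pos).ne'
  have hχs : Function.Surjective χ := by
    intro c
    -- Summing over conjugates multiplies a scalar operator by |G|, and the trace multiplies it by
    -- the dimension; the denominator cancels both.
    obtain ⟨x, hx⟩ := hsurj fun i =>
      (c i / (Fintype.card G * Module.finrank ℂ (V i))) • (1 : Module.End ℂ (V i))
    obtain ⟨f, hf⟩ := exists_conjSum_eq x
    refine ⟨f, funext fun i => ?_⟩
    rw [hχ, ← hf, fourier_conjSum, hx]
    simp only [mul_smul_comm, mul_one, smul_mul_assoc, ← map_mul, mul_inv_cancel, map_one,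
      Finset.sum_const, Finset.card_univ, map_nsmul, map_smul, LinearMap.trace_one]
    rw [nsmul_eq_mul, smul_eq_mul]
    have := hdim i
    field_simp
  have hχi : Function.Injective χ := by
    have h1 : Module.finrank ℂ (ConjClasses G → ℂ) = Module.finrank ℂ (ι → ℂ) := by
      refine le_antisymm ?_ (LinearMap.finrank_le_finrank_of_surjective hχs)
      simpa using hcard
    exact (LinearMap.injective_iff_surjective_of_finrank_eq_finrank h1).2 hχs
  rw [injective_iff_map_eq_zero]
  intro x hx
  by_contra hne
  obtain ⟨k, hk⟩ := Function.ne_iff.1 hne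
  -- Right translation moves the nonzero value to the identity: y 1 = x k.
  set y : G → ℂ := fun h => x (1⁻¹ * h * k) with hy
  have hy0 : fourier ρ y = 0 := by
    funext i
    rw [hy, fourier_translate, hx]
    simp
  obtain ⟨f, hf⟩ := exists_conjSum_eq y
  have hf0 : f = 0 := hχi <| by
    rw [map_zero]
    funext i
    rw [hχ, ← hf, fourier_conjSum, hy0]
    simp
  have h1 : conjSum y 1 = Fintype.card G * x k := by
    simp [conjSum, hy]
  rw [hf, hf0] at h1
  simp only [Function.comp_apply, Pi.zero_apply] at h1
  exact mul_ne_zero hG hk h1.symm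

end Fourier

theorem card_conjClasses_perm_le (b : ℕ) :
    Nat.card (ConjClasses (Equiv.Perm (Fin b))) ≤ Fintype.card (Nat.Partition b) := by
  classical
  -- The cycle partition of a permutation has type `Nat.Partition (Fintype.card (Fin b))`, so the
  -- index must be transported.
  have key : ∀ n, n = Fintype.card (Fin b) → Fintype.card (Nat.Partition n) =
      Fintype.card (Nat.Partition (Fintype.card (Fin b))) := by
    rintro _ rfl; rfl
  rw [key b (by simp), ← Nat.card_eq_fintype_card]
  refine Nat.card_le_card_of_injective
    (Quotient.lift (fun σ : Equiv.Perm (Fin b) => σ.partition) fun σ τ h =>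
      Equiv.Perm.partition_eq_of_isConj.1 h) ?_
  intro x y
  refine Quotient.inductionOn₂ x y fun σ τ h => ?_
  exact Quotient.sound (Equiv.Perm.partition_eq_of_isConj.2 h)

/-! ### Combinatorics of tableaux -/

theorem card_cellsOfRowLens (w : List ℕ) : (YoungDiagram.cellsOfRowLens w).card = w.sum := by
  induction w with
  | nil => rfl
  | cons n w ih =>
    rw [YoungDiagram.cellsOfRowLens, Finset.card_union_of_disjoint]
    · simp [ih]
    · rw [Finset.disjoint_left]
      rintro ⟨i, j⟩ h1 h2
      simp only [Finset.singleton_product, Finset.mem_map, Function.Embedding.coeFn_mk,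
        Prod.mk.injEq, Function.Embedding.prodMap] at h1 h2
      aesop

section Tableaux

variable {b : ℕ} {ν μ : Nat.Partition b}

theorem card_shape (ν : Nat.Partition b) : (shape ν).cells.card = b := by
  have : (shape ν).cells = YoungDiagram.cellsOfRowLens (ν.parts.sort (· ≥ ·)) := rfl
  rw [this, card_cellsOfRowLens, ← Multiset.sum_coe, Multiset.sort_eq, ν.parts_sum]

instance (ν : Nat.Partition b) : Nonempty (Tableau ν) :=
  ⟨Fintype.equivOfCardEq (by simp [card_shape])⟩

theorem rowLens_shape (ν : Nat.Partition b) : (shape ν).rowLens = ν.parts.sort (· ≥ ·) :=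
  YoungDiagram.rowLens_ofRowLens_eq_self fun _ hx => ν.parts_pos ((Multiset.mem_sort _).1 hx)

theorem shape_injective : Function.Injective (shape (b := b)) := by
  intro ν μ h
  have := congrArg (fun w : List ℕ => (w : Multiset ℕ)) (congrArg YoungDiagram.rowLens h)
  simp only [rowLens_shape, Multiset.sort_eq] at this
  exact Nat.Partition.ext this

namespace Tableau

theorem mem_shape (t : Tableau ν) (x : Fin b) : (t.row x, t.col x) ∈ shape ν :=
  (t.symm x).2

theorem ext_cell (t : Tableau ν) {x y : Fin b} (hr : t.row x = t.row y)
    (hc : t.col x = t.col y) : x = y :=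
  t.symm.injective (Subtype.ext (Prod.ext hr hc))

theorem exists_cell (t : Tableau ν) {i j : ℕ} (h : (i, j) ∈ shape ν) :
    ∃ x, t.row x = i ∧ t.col x = j :=
  ⟨t.symm.symm ⟨(i, j), h⟩, by rw [row, Equiv.apply_symm_apply],
    by rw [col, Equiv.apply_symm_apply]⟩

theorem rowLen_eq_card (t : Tableau ν) (i : ℕ) :
    (shape ν).rowLen i = (Finset.univ.filter fun x => t.row x = i).card := by
  rw [← Finset.card_range ((shape ν).rowLen i)]
  symm
  refine Finset.card_bij (fun x _ => t.col x) ?_ ?_ ?_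
  · intro x hx
    obtain rfl := (Finset.mem_filter.1 hx).2
    exact Finset.mem_range.2 (YoungDiagram.mem_iff_lt_rowLen.1 (t.mem_shape x))
  · intro x hx y hy h
    exact t.ext_cell (((Finset.mem_filter.1 hx).2).trans (Finset.mem_filter.1 hy).2.symm) h
  · intro j hj
    obtain ⟨x, hx, rfl⟩ :=
      t.exists_cell (YoungDiagram.mem_iff_lt_rowLen.2 (Finset.mem_range.1 hj))
    exact ⟨x, by simpa using hx, rfl⟩

/-- The sum of the row numbers of the cells of the Young diagram of `ν`. -/
def _root_.Foulkes.rowWeight (ν : Nat.Partition b) : ℕ := ∑ c : {c // c ∈ (shape ν).cells}, c.1.1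

theorem sum_row (t : Tableau ν) : ∑ x, t.row x = rowWeight ν :=
  Fintype.sum_equiv t.symm _ _ fun _ => rfl

/-- The permutation that sorts each column of `t` by the row numbers in `s`. -/
theorem exists_sort (t : Tableau ν) (s : Tableau μ)
    (h : ∀ x y, t.col x = t.col y → s.row x = s.row y → x = y) :
    ∃ π : Equiv.Perm (Fin b), ∀ x, t.col (π x) = t.col x ∧ t.row (π x) ≤ s.row x := by
  -- The rank of x within its column of t, when letters are ordered by their rows in s, is the size
  -- of `r x`. The permutation sends x to the letter of t in the same column and in the row of that
  -- number. The rank is at most `s.row x` since the column has distinct rows in s.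
  let r : Fin b → Finset (Fin b) := fun x =>
    Finset.univ.filter fun y => t.col y = t.col x ∧ s.row y < s.row x
  have hr : ∀ x, (r x).card ≤ s.row x := fun x => by
    rw [← Finset.card_range (s.row x)]
    refine Finset.card_le_card_of_injOn s.row ?_ ?_
    · intro y hy
      exact Finset.mem_coe.2 (Finset.mem_range.2 (Finset.mem_filter.1 hy).2.2)
    · intro y hy z hz hyz
      exact h y z (((Finset.mem_filter.1 hy).2.1).trans (Finset.mem_filter.1 hz).2.1.symm) hyz
  have hc : ∀ x, (r x).card < (shape ν).colLen (t.col x) := fun x => by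
    have h1 : (r x).card < (Finset.univ.filter fun y => t.col y = t.col x).card := by
      refine Finset.card_lt_card (Finset.ssubset_iff_subset_ne.2 ⟨?_, ?_⟩)
      · intro y hy
        exact Finset.mem_filter.2 ⟨Finset.mem_univ _, (Finset.mem_filter.1 hy).2.1⟩
      · intro he
        have hx : x ∈ r x := he ▸ Finset.mem_filter.2 ⟨Finset.mem_univ _, rfl⟩
        exact lt_irrefl _ (Finset.mem_filter.1 hx).2.2
    refine h1.trans_le ?_
    rw [← Finset.card_range ((shape ν).colLen (t.col x))]
    refine Finset.card_le_card_of_injOn t.row ?_ ?_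
    · intro y hy
      have hy' : t.col y = t.col x := (Finset.mem_filter.1 hy).2
      exact Finset.mem_coe.2 (Finset.mem_range.2
        (YoungDiagram.mem_iff_lt_colLen.1 (hy' ▸ t.mem_shape y)))
    · intro y hy z hz hyz
      exact t.ext_cell hyz (((Finset.mem_filter.1 hy).2).trans (Finset.mem_filter.1 hz).2.symm)
  have hlt : ∀ x y, t.col x = t.col y → s.row x < s.row y → (r x).card < (r y).card := by
    intro x y hxy hlt
    refine Finset.card_lt_card (Finset.ssubset_iff_subset_ne.2 ⟨?_, ?_⟩)
    · intro z hz
      obtain ⟨-, h1, h2⟩ := Finset.mem_filter.1 hz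
      exact Finset.mem_filter.2 ⟨Finset.mem_univ _, h1.trans hxy, h2.trans hlt⟩
    · intro he
      have hx : x ∈ r x := he ▸ Finset.mem_filter.2 ⟨Finset.mem_univ _, hxy, hlt⟩
      exact lt_irrefl _ (Finset.mem_filter.1 hx).2.2
  choose p hp1 hp2 using fun x => t.exists_cell (YoungDiagram.mem_iff_lt_colLen.2 (hc x))
  have hinj : Function.Injective p := by
    intro x y hxy
    have hcol : t.col x = t.col y := by rw [← hp2 x, ← hp2 y, hxy]
    have hcard : (r x).card = (r y).card := by rw [← hp1 x, ← hp1 y, hxy]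
    rcases lt_trichotomy (s.row x) (s.row y) with hl | he | hl
    · exact absurd hcard (hlt x y hcol hl).ne
    · exact h x y hcol he
    · exact absurd hcard (hlt y x hcol.symm hl).ne'
  refine ⟨Equiv.ofBijective p (Finite.injective_iff_bijective.1 hinj), fun x => ⟨hp2 x, ?_⟩⟩
  change t.row (p x) ≤ s.row x
  rw [hp1]
  exact hr x

/-- This plays the role of the dominance lemma, with a numerical weight in place of the dominance
order. Sorting columns gives a termwise inequality of row numbers; summing it compares the weights,
and equal sums force termwise equality. -/
theorem rowWeight_lt_or_exists_sort (t : Tableau ν) (s : Tableau μ)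
    (h : ∀ x y, t.col x = t.col y → s.row x = s.row y → x = y) :
    rowWeight ν < rowWeight μ ∨
      ∃ π : Equiv.Perm (Fin b), (∀ x, t.col (π x) = t.col x) ∧ ∀ x, t.row (π x) = s.row x := by
  obtain ⟨π, hπ⟩ := exists_sort t s h
  have hsum : ∑ x, t.row (π x) = rowWeight ν := by
    rw [← t.sum_row]; exact Equiv.sum_comp π t.row
  rcases (Finset.sum_le_sum fun x (_ : x ∈ Finset.univ) => (hπ x).2).lt_or_eq with hl | he
  · left
    rwa [hsum, s.sum_row] at hl
  · right
    exact ⟨π, fun x => (hπ x).1, fun x =>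
      (Finset.sum_eq_sum_iff_of_le fun x _ => (hπ x).2).1 he x (Finset.mem_univ x)⟩

/-- The permutation matches the rows of s with those of t, so all row lengths agree. -/
theorem partition_eq_of_row_eq (t : Tableau ν) (s : Tableau μ) (π : Equiv.Perm (Fin b))
    (h : ∀ x, t.row (π x) = s.row x) : ν = μ := by
  refine shape_injective (YoungDiagram.ext ?_)
  ext ⟨i, j⟩
  simp only [YoungDiagram.mem_cells, YoungDiagram.mem_iff_lt_rowLen]
  have : (shape ν).rowLen i = (shape μ).rowLen i := by
    rw [t.rowLen_eq_card, s.rowLen_eq_card]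
    symm
    refine Finset.card_bij (fun x _ => π x) ?_ (fun x _ y _ hxy => π.injective hxy) ?_
    · intro x hx
      simpa [h] using hx
    · intro y hy
      refine ⟨π⁻¹ y, ?_, by simp⟩
      simpa [← h] using hy
  rw [this]

/-- Tableaux of equal shape differ by a permutation of the letters. -/
theorem exists_smul_eq (t s : Tableau ν) : ∃ σ : Equiv.Perm (Fin b), σ • t = s :=
  have key : ∀ e f : {c // c ∈ (shape ν).cells} ≃ Fin b, e.trans (e.symm.trans f) = f :=
    fun e f => by ext; simp
  ⟨t.symm.trans s, key t s⟩

theorem tabloid_eq_iff {s t : Tableau ν} : s.tabloid = t.tabloid ↔ ∀ x, s.row x = t.row x :=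
  Quotient.eq (r := Tableau.rowSetoid ν)

end Tableau

instance (ν : Nat.Partition b) : Finite (Tableau ν) :=
  inferInstanceAs (Finite ({c : ℕ × ℕ // c ∈ (shape ν).cells} ≃ Fin b))

instance (ν : Nat.Partition b) : Finite (Tabloid ν) :=
  inferInstanceAs (Finite (Quotient (Tableau.rowSetoid ν)))

theorem Tabloid.exists_rep (T : Tabloid ν) : ∃ t : Tableau ν, t.tabloid = T :=
  Quotient.exists_rep (s := Tableau.rowSetoid ν) T

end Tableaux

/-! ### The group algebra of the symmetric group and Specht modules -/

section SpechtTheory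

variable {b : ℕ} {ν μ : Nat.Partition b}

instance (ν : Nat.Partition b) : Fintype (Tabloid ν) := Fintype.ofFinite _

/-- The standard bilinear form on the permutation module of tabloids. -/
def tabloidForm (ν : Nat.Partition b) : ℂ[Tabloid ν] →ₗ[ℂ] ℂ[Tabloid ν] →ₗ[ℂ] ℂ :=
  LinearMap.mk₂ ℂ (fun v w => ∑ T, v.coeff T * w.coeff T)
    (fun v v' w => by simp [add_mul, Finset.sum_add_distrib])
    (fun c v w => by simp [Finset.mul_sum, mul_assoc])
    (fun v w w' => by simp [mul_add, Finset.sum_add_distrib])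
    (fun c v w => by simp [Finset.mul_sum, mul_left_comm])

theorem tabloidForm_apply (v w : ℂ[Tabloid ν]) :
    tabloidForm ν v w = ∑ T, v.coeff T * w.coeff T := rfl

theorem tabloidForm_single (T : Tabloid ν) (w : ℂ[Tabloid ν]) :
    tabloidForm ν (MonoidAlgebra.single T 1) w = w.coeff T := by
  classical
  simp [tabloidForm_apply, MonoidAlgebra.coeff_single, Finsupp.single_apply]

theorem tabloidForm_comm (v w : ℂ[Tabloid ν]) : tabloidForm ν v w = tabloidForm ν w v := by
  simp [tabloidForm_apply, mul_comm]

theorem tabloidForm_smul_left (σ : Equiv.Perm (Fin b)) (v w : ℂ[Tabloid ν]) :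
    tabloidForm ν (Representation.ofMulAction ℂ _ (Tabloid ν) σ v) w =
      tabloidForm ν v (Representation.ofMulAction ℂ _ (Tabloid ν) σ⁻¹ w) := by
  simp only [tabloidForm_apply, Representation.coeff_ofMulAction, inv_inv]
  refine Fintype.sum_equiv (MulAction.toPerm σ⁻¹) _ _ fun T => ?_
  simp

/-! ### Signed column sums acting on tabloids -/

open Classical in
/-- The signed column sum of `t`, as a function on the symmetric group. -/
def columnSum (t : Tableau ν) (π : Equiv.Perm (Fin b)) : ℂ :=
  if ∀ x, t.col (π x) = t.col x then ((Equiv.Perm.sign π : ℤ) : ℂ) else 0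

theorem columnSum_mul_left (t : Tableau ν) {σ : Equiv.Perm (Fin b)}
    (hσ : ∀ x, t.col (σ x) = t.col x) (π : Equiv.Perm (Fin b)) :
    columnSum t (σ * π) = ((Equiv.Perm.sign σ : ℤ) : ℂ) * columnSum t π := by
  simp [columnSum, hσ]

theorem columnSum_mul_right (t : Tableau ν) {σ : Equiv.Perm (Fin b)}
    (hσ : ∀ x, t.col (σ x) = t.col x) (π : Equiv.Perm (Fin b)) :
    columnSum t (π * σ) = ((Equiv.Perm.sign σ : ℤ) : ℂ) * columnSum t π := by
  have : (∀ x, t.col ((π * σ) x) = t.col x) ↔ ∀ x, t.col (π x) = t.col x := by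
    refine ⟨fun h x => ?_, fun h x => by rw [Equiv.Perm.mul_apply, h, hσ]⟩
    have h1 := h (σ.symm x)
    have h2 := hσ (σ.symm x)
    rw [Equiv.Perm.mul_apply, Equiv.apply_symm_apply] at h1
    rw [Equiv.apply_symm_apply] at h2
    rw [h1, h2]
  unfold columnSum
  simp only [this]
  simp [mul_comm]

theorem sign_mul_self (σ : Equiv.Perm (Fin b)) :
    ((Equiv.Perm.sign σ : ℤ) : ℂ) * ((Equiv.Perm.sign σ : ℤ) : ℂ) = 1 := by
  rcases Int.units_eq_one_or (Equiv.Perm.sign σ) with h | h <;> simp [h]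

theorem polytabloid_eq_sum (t : Tableau ν) :
    polytabloid t = ∑ π, columnSum t π • MonoidAlgebra.single (π • t.tabloid) (1 : ℂ) := by
  classical
  simp only [polytabloid, columnSum, Finset.sum_filter, ite_smul, zero_smul]
  refine Finset.sum_congr rfl fun π _ => ?_
  split_ifs <;> simp [Tableau.smul_tabloid]

theorem coeff_polytabloid_smul (t : Tableau ν) {σ : Equiv.Perm (Fin b)}
    (hσ : ∀ x, t.col (σ x) = t.col x) (T : Tabloid ν) :
    (polytabloid t).coeff (σ • T) =
      ((Equiv.Perm.sign σ : ℤ) : ℂ) * (polytabloid t).coeff T := by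
  classical
  simp only [polytabloid_eq_sum, MonoidAlgebra.coeff_sum, Finsupp.finsetSum_apply,
    MonoidAlgebra.coeff_smul_apply, MonoidAlgebra.coeff_single, Finsupp.single_apply,
    Finset.mul_sum]
  refine Fintype.sum_equiv (Equiv.mulLeft σ⁻¹) _ _ fun π => ?_
  simp only [Equiv.coe_mulLeft, mul_smul, inv_smul_eq_iff, smul_eq_mul]
  rw [← mul_assoc, ← columnSum_mul_left t hσ, mul_inv_cancel_left]

theorem coeff_polytabloid_self (t : Tableau ν) : (polytabloid t).coeff t.tabloid = 1 := by
  classical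
  simp only [polytabloid_eq_sum, MonoidAlgebra.coeff_sum, Finsupp.finsetSum_apply,
    MonoidAlgebra.coeff_smul_apply, MonoidAlgebra.coeff_single, Finsupp.single_apply]
  -- Only the identity preserves both the columns and the rows of t.
  rw [Finset.sum_eq_single 1]
  · simp [columnSum]
  · intro π _ hπ
    by_cases hc : ∀ x, t.col (π x) = t.col x
    · have : π • t.tabloid ≠ t.tabloid := by
        intro he
        rw [Tableau.smul_tabloid, Tableau.tabloid_eq_iff] at he
        refine hπ (Equiv.ext fun x => t.ext_cell ?_ (hc x))
        have := he (π x)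
        rw [Tableau.row_smul, Equiv.Perm.coe_inv, Equiv.symm_apply_apply] at this
        exact this.symm
      simp [this]
    · simp [columnSum, hc]
  · simp

/-- The action of the signed column sum of `t` on the permutation module of tabloids. -/
def columnOp (t : Tableau ν) (μ : Nat.Partition b) : Module.End ℂ ℂ[Tabloid μ] :=
  ∑ π, columnSum t π • Representation.ofMulAction ℂ (Equiv.Perm (Fin b)) (Tabloid μ) π

theorem columnOp_single (t : Tableau ν) (T : Tabloid μ) :
    columnOp t μ (MonoidAlgebra.single T 1) =
      ∑ π, columnSum t π • MonoidAlgebra.single (π • T) (1 : ℂ) := by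
  simp [columnOp, LinearMap.sum_apply]

theorem columnOp_single_smul (t : Tableau ν) {σ : Equiv.Perm (Fin b)}
    (hσ : ∀ x, t.col (σ x) = t.col x) (T : Tabloid μ) :
    columnOp t μ (MonoidAlgebra.single (σ • T) 1) =
      ((Equiv.Perm.sign σ : ℤ) : ℂ) • columnOp t μ (MonoidAlgebra.single T 1) := by
  rw [columnOp_single, columnOp_single, Finset.smul_sum]
  refine Fintype.sum_equiv (Equiv.mulRight σ) _ _ fun π => ?_
  simp only [Equiv.coe_mulRight]
  rw [columnSum_mul_right t hσ, mul_smul π, ← mul_smul (_ : ℂ), ← mul_assoc, sign_mul_self,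
    one_mul]

theorem swap_smul_tabloid (s : Tableau μ) {x y : Fin b} (h : s.row x = s.row y) :
    Equiv.swap x y • s.tabloid = s.tabloid := by
  rw [Tableau.smul_tabloid, Tableau.tabloid_eq_iff]
  intro z
  rw [Tableau.row_smul, Equiv.swap_inv]
  rcases eq_or_ne z x with rfl | hx
  · rw [Equiv.swap_apply_left, h]
  rcases eq_or_ne z y with rfl | hy
  · rw [Equiv.swap_apply_right, h]
  rw [Equiv.swap_apply_of_ne_of_ne hx hy]

theorem col_swap (t : Tableau ν) {x y : Fin b} (h : t.col x = t.col y) (z : Fin b) :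
    t.col (Equiv.swap x y z) = t.col z := by
  rcases eq_or_ne z x with rfl | hx
  · rw [Equiv.swap_apply_left, h]
  rcases eq_or_ne z y with rfl | hy
  · rw [Equiv.swap_apply_right, h]
  rw [Equiv.swap_apply_of_ne_of_ne hx hy]

/-- The transposition of x and y fixes the tabloid of s but changes the sign of the column sum, so
the image equals its own negative. -/
theorem columnOp_single_eq_zero (t : Tableau ν) (s : Tableau μ) {x y : Fin b} (hne : x ≠ y)
    (hc : t.col x = t.col y) (hr : s.row x = s.row y) :
    columnOp t μ (MonoidAlgebra.single s.tabloid 1) = 0 := by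
  have h := columnOp_single_smul t (col_swap t hc) s.tabloid
  rw [swap_smul_tabloid s hr, Equiv.Perm.sign_swap hne] at h
  rw [Units.val_neg, Units.val_one, Int.cast_neg, Int.cast_one, neg_one_smul,
    eq_neg_iff_add_eq_zero, ← two_smul ℂ] at h
  exact (smul_eq_zero.1 h).resolve_left two_ne_zero

theorem columnOp_eq_zero (t : Tableau ν) (hne : ν ≠ μ) (hw : ¬ rowWeight ν < rowWeight μ) :
    columnOp t μ = 0 := by
  refine MonoidAlgebra.lhom_ext' fun T => LinearMap.ext_ring ?_
  obtain ⟨s, rfl⟩ := T.exists_rep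
  change columnOp t μ (MonoidAlgebra.single s.tabloid 1) = 0
  by_cases h : ∀ x y, t.col x = t.col y → s.row x = s.row y → x = y
  · rcases t.rowWeight_lt_or_exists_sort s h with hl | ⟨π, -, hπ⟩
    · exact absurd hl hw
    · exact absurd (t.partition_eq_of_row_eq s π hπ) hne
  · push Not at h
    obtain ⟨x, y, hc, hr, hxy⟩ := h
    exact columnOp_single_eq_zero t s hxy hc hr

/-- Both sides are compared on a tabloid {s}. If two letters share a column of t and a row of s,
both vanish. Otherwise a column permutation π of t carries {s} to {t}, and both sides equal sgn(π)
e_t. -/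
theorem columnOp_apply (t : Tableau ν) (v : ℂ[Tabloid ν]) :
    columnOp t ν v = tabloidForm ν v (polytabloid t) • polytabloid t := by
  suffices h : columnOp t ν = ((tabloidForm ν).flip (polytabloid t)).smulRight (polytabloid t) by
    rw [h]; rfl
  refine MonoidAlgebra.lhom_ext' fun T => LinearMap.ext_ring ?_
  obtain ⟨s, rfl⟩ := T.exists_rep
  change columnOp t ν (MonoidAlgebra.single s.tabloid 1) =
    tabloidForm ν (MonoidAlgebra.single s.tabloid 1) (polytabloid t) • polytabloid t
  rw [tabloidForm_single]
  by_cases h : ∀ x y, t.col x = t.col y → s.row x = s.row y → x = y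
  · rcases t.rowWeight_lt_or_exists_sort s h with hl | ⟨π, hc, hr⟩
    · exact absurd hl (lt_irrefl _)
    · have hs : π • s.tabloid = t.tabloid := by
        rw [Tableau.smul_tabloid, Tableau.tabloid_eq_iff]
        intro x
        rw [Tableau.row_smul, ← hr, Equiv.Perm.coe_inv, Equiv.apply_symm_apply]
      have h1 := columnOp_single_smul t hc s.tabloid
      have h2 := coeff_polytabloid_smul t hc s.tabloid
      rw [hs, columnOp_single, ← polytabloid_eq_sum] at h1
      rw [hs, coeff_polytabloid_self] at h2
      have h3 : (polytabloid t).coeff s.tabloid = ((Equiv.Perm.sign π : ℤ) : ℂ) := by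
        rw [← mul_one ((Equiv.Perm.sign π : ℤ) : ℂ), h2, ← mul_assoc, sign_mul_self, one_mul]
      rw [h3, h1, smul_smul, sign_mul_self, one_smul]
  · push Not at h
    obtain ⟨x, y, hc, hr, hxy⟩ := h
    rw [columnOp_single_eq_zero t s hxy hc hr]
    have h2 := coeff_polytabloid_smul t (col_swap t hc) s.tabloid
    rw [swap_smul_tabloid s hr, Equiv.Perm.sign_swap hxy] at h2
    have h3 : (polytabloid t).coeff s.tabloid = 0 := by simpa [self_eq_neg] using h2
    rw [h3, zero_smul]

/-! ### Self-duality and endomorphisms of Specht modules -/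

/-- Complex conjugation of the coefficients. -/
def conjTabloid (v : ℂ[Tabloid ν]) : ℂ[Tabloid ν] :=
  ∑ T, MonoidAlgebra.single T (starRingEnd ℂ (v.coeff T))

theorem coeff_conjTabloid (v : ℂ[Tabloid ν]) (T : Tabloid ν) :
    (conjTabloid v).coeff T = starRingEnd ℂ (v.coeff T) := by
  classical
  simp [conjTabloid, MonoidAlgebra.coeff_sum, Finsupp.finsetSum_apply,
    MonoidAlgebra.coeff_single, Finsupp.single_apply]

theorem tabloid_ext {v w : ℂ[Tabloid ν]} (h : ∀ T, v.coeff T = w.coeff T) : v = w :=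
  MonoidAlgebra.coeff_injective (Finsupp.ext h)

theorem conjTabloid_polytabloid (t : Tableau ν) : conjTabloid (polytabloid t) = polytabloid t := by
  classical
  refine tabloid_ext fun T => ?_
  simp only [coeff_conjTabloid, polytabloid, MonoidAlgebra.coeff_sum, Finsupp.finsetSum_apply,
    MonoidAlgebra.coeff_single, Finsupp.single_apply, map_sum]
  refine Finset.sum_congr rfl fun π _ => ?_
  split_ifs <;> simp

/-- Polytabloids have integer coefficients, so their complex span is stable under conjugation. -/
theorem conjTabloid_mem {v : ℂ[Tabloid ν]} (hv : v ∈ (spechtSub ν).toSubmodule) :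
    conjTabloid v ∈ (spechtSub ν).toSubmodule := by
  change v ∈ Submodule.span ℂ (Set.range polytabloid) at hv
  induction hv using Submodule.span_induction with
  | mem v hv =>
    obtain ⟨t, rfl⟩ := hv
    rw [conjTabloid_polytabloid]
    exact Submodule.subset_span ⟨t, rfl⟩
  | zero =>
    convert Submodule.zero_mem _
    exact tabloid_ext fun T => by simp [coeff_conjTabloid]
  | add v w _ _ hv hw =>
    convert Submodule.add_mem _ hv hw
    exact tabloid_ext fun T => by simp [coeff_conjTabloid]
  | smul c v _ hv =>
    convert Submodule.smul_mem _ (starRingEnd ℂ c) hv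
    exact tabloid_ext fun T => by simp [coeff_conjTabloid]

theorem eq_zero_of_tabloidForm_conj {v : ℂ[Tabloid ν]} (h : tabloidForm ν v (conjTabloid v) = 0) :
    v = 0 := by
  refine tabloid_ext fun T => ?_
  have h1 : ∑ T, Complex.normSq (v.coeff T) = 0 := by
    have : ((∑ T, Complex.normSq (v.coeff T) : ℝ) : ℂ) = 0 := by
      rw [← h, tabloidForm_apply]
      simp [coeff_conjTabloid, Complex.mul_conj]
    exact_mod_cast this
  have h2 := (Finset.sum_eq_zero_iff_of_nonneg fun T _ => Complex.normSq_nonneg _).1 h1 T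
    (Finset.mem_univ T)
  simpa using h2

instance (ν : Nat.Partition b) : Module.Finite ℂ ℂ[Tabloid ν] :=
  Module.Finite.equiv (MonoidAlgebra.coeffLinearEquiv ℂ).symm

instance (ν : Nat.Partition b) : Module.Finite ℂ (spechtSub ν).toSubmodule :=
  inferInstance

instance (ν : Nat.Partition b) : Nontrivial (spechtSub ν).toSubmodule := by
  obtain ⟨t⟩ : Nonempty (Tableau ν) := inferInstance
  refine ⟨spechtVec t, 0, fun h => ?_⟩
  have h1 : polytabloid t = 0 := congrArg Subtype.val h
  have h2 := coeff_polytabloid_self t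
  rw [h1] at h2
  simp at h2

theorem span_spechtVec (ν : Nat.Partition b) :
    Submodule.span ℂ (Set.range (spechtVec (ν := ν))) = ⊤ := by
  rw [eq_top_iff]
  rintro ⟨v, hv⟩ -
  change v ∈ Submodule.span ℂ (Set.range polytabloid) at hv
  have : Submodule.map (spechtSub ν).toSubmodule.subtype
      (Submodule.span ℂ (Set.range (spechtVec (ν := ν)))) =
        Submodule.span ℂ (Set.range polytabloid) := by
    rw [Submodule.map_span, ← Set.range_comp]
    rfl
  have hv' := hv
  rw [← this] at hv'
  obtain ⟨w, hw, h⟩ := hv'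
  rwa [show (⟨v, hv⟩ : (spechtSub ν).toSubmodule) = w from Subtype.ext h.symm]

/-- The Specht module is self-dual. -/
def spechtDual (ν : Nat.Partition b) :
    (spechtSub ν).toSubmodule ≃ₗ[ℂ] Module.Dual ℂ (spechtSub ν).toSubmodule :=
  LinearEquiv.ofInjectiveOfFinrankEq
    ((tabloidForm ν).domRestrict₁₂ (spechtSub ν).toSubmodule (spechtSub ν).toSubmodule)
    (by
      rw [injective_iff_map_eq_zero]
      rintro ⟨v, hv⟩ h
      refine Subtype.ext (eq_zero_of_tabloidForm_conj ?_)
      -- Pairing v with its own conjugate gives the sum of the |v_T|², so the bilinear form is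
      -- nondegenerate on the Specht module although it is not Hermitian.
      exact LinearMap.congr_fun h ⟨conjTabloid v, conjTabloid_mem hv⟩)
    (Subspace.dual_finrank_eq).symm

theorem spechtDual_apply (v w : (spechtSub ν).toSubmodule) :
    spechtDual ν v w = tabloidForm ν v.1 w.1 := rfl

/-- The tensor square of a Specht module is its endomorphism algebra. -/
def spechtEnd (ν : Nat.Partition b) :
    (spechtSub ν).toSubmodule ⊗[ℂ] (spechtSub ν).toSubmodule ≃ₗ[ℂ]
      Module.End ℂ (spechtSub ν).toSubmodule :=
  TensorProduct.comm ℂ _ _ ≪≫ₗ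
    TensorProduct.congr (spechtDual ν) (LinearEquiv.refl ℂ _) ≪≫ₗ dualTensorHomEquiv ℂ _ _

theorem spechtEnd_tmul (u v w : (spechtSub ν).toSubmodule) :
    spechtEnd ν (u ⊗ₜ v) w = tabloidForm ν v.1 w.1 • u := by
  simp [spechtEnd, spechtDual_apply]

/-- Invariance of the form turns h acting on the functional into precomposition with h⁻¹. -/
theorem spechtEnd_smul (g h : Equiv.Perm (Fin b)) (u v : (spechtSub ν).toSubmodule) :
    spechtEnd ν (specht ν g u ⊗ₜ specht ν h v) =
      specht ν g * spechtEnd ν (u ⊗ₜ v) * specht ν h⁻¹ := by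
  refine LinearMap.ext fun w => ?_
  rw [Module.End.mul_apply, Module.End.mul_apply, spechtEnd_tmul, spechtEnd_tmul, map_smul]
  congr 1
  exact tabloidForm_smul_left h v.1 w.1

/-! ### Decomposition of the regular bimodule -/

theorem fourier_columnSum_apply (t : Tableau ν) (w : (spechtSub μ).toSubmodule) :
    (fourier (specht (b := b)) (columnSum t) μ w : ℂ[Tabloid μ]) = columnOp t μ w := by
  rw [fourier_apply, columnOp, LinearMap.sum_apply, LinearMap.sum_apply, Submodule.coe_sum]
  rfl

theorem fourier_columnSum_self (t : Tableau ν) :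
    fourier (specht (b := b)) (columnSum t) ν = spechtEnd ν (spechtVec t ⊗ₜ spechtVec t) := by
  refine LinearMap.ext fun w => Subtype.ext ?_
  rw [fourier_columnSum_apply, columnOp_apply, spechtEnd_tmul, tabloidForm_comm]
  rfl

theorem fourier_columnSum_eq_zero (t : Tableau ν) (hne : ν ≠ μ)
    (hw : ¬ rowWeight ν < rowWeight μ) :
    fourier (specht (b := b)) (columnSum t) μ = 0 := by
  refine LinearMap.ext fun w => Subtype.ext ?_
  rw [fourier_columnSum_apply, columnOp_eq_zero t hne hw]
  rfl

theorem eq_top_of_spechtVec_tmul_mem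
    {R : Submodule ℂ ((spechtSub ν).toSubmodule ⊗[ℂ] (spechtSub ν).toSubmodule)}
    (h : ∀ s t, spechtVec s ⊗ₜ spechtVec t ∈ R) : R = ⊤ := by
  rw [eq_top_iff, ← TensorProduct.map₂_mk_top_top_eq_top, ← span_spechtVec,
    Submodule.map₂_span_span, Submodule.span_le]
  rintro _ ⟨_, ⟨s, rfl⟩, _, ⟨t, rfl⟩, rfl⟩
  exact h s t

/-- The column sum of a ν-tableau t acts on S^ν as e_t ⊗ e_t and is zero on every other S^μ unless μ
has larger row weight. Left translates give e_{σt} ⊗ e_t, and these span End(S^ν). Downward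
induction on the row weight removes the remaining components. -/
theorem fourier_specht_surjective (b : ℕ) : Function.Surjective (fourier (specht (b := b))) := by
  classical
  set R := LinearMap.range (fourier (specht (b := b))) with hR
  -- The number k is the distance of the row weight from its maximum, so larger weights come earlier
  -- in the strong induction.
  have key : ∀ (k : ℕ) (ν : Nat.Partition b),
      Finset.univ.sup (rowWeight (b := b)) - rowWeight ν = k →
        ∀ A : Module.End ℂ (spechtSub ν).toSubmodule, Pi.single ν A ∈ R := by
    intro k
    induction k using Nat.strong_induction_on with
    | _ k ih =>
      intro ν hk A
      let Q := R.comap ((LinearMap.single ℂ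
        (fun ν : Nat.Partition b => Module.End ℂ (spechtSub ν).toSubmodule) ν) ∘ₗ
          (spechtEnd ν).toLinearMap)
      have hQ : Q = ⊤ := by
        refine eq_top_of_spechtVec_tmul_mem fun s t => ?_
        obtain ⟨σ, rfl⟩ := t.exists_smul_eq s
        change Pi.single ν (spechtEnd ν (spechtVec (σ • t) ⊗ₜ spechtVec t)) ∈ R
        have hx : fourier (specht (b := b)) (fun k => columnSum t (σ⁻¹ * k * 1)) ∈ R :=
          LinearMap.mem_range_self _ _
        rw [← Finset.univ_sum_single (fourier (specht (b := b)) _),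
          ← Finset.add_sum_erase _ _ (Finset.mem_univ ν)] at hx
        have he : spechtEnd ν (spechtVec (σ • t) ⊗ₜ spechtVec t) =
            fourier (specht (b := b)) (fun k => columnSum t (σ⁻¹ * k * 1)) ν := by
          rw [fourier_translate, fourier_columnSum_self, ← spechtEnd_smul, specht_spechtVec,
            map_one, Module.End.one_apply]
        rw [he]
        refine (Submodule.add_mem_iff_left _ (Submodule.sum_mem _ fun μ hμ => ?_)).1 hx
        have hne : ν ≠ μ := (Finset.ne_of_mem_erase hμ).symm
        by_cases hw : rowWeight ν < rowWeight μ
        · have hle : rowWeight μ ≤ Finset.univ.sup (rowWeight (b := b)) :=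
            Finset.le_sup (Finset.mem_univ μ)
          exact ih _ (by omega) μ rfl _
        · rw [fourier_translate, fourier_columnSum_eq_zero t hne hw]
          simp
      have : (spechtEnd ν).symm A ∈ Q := hQ ▸ Submodule.mem_top
      simpa [Q] using this
  intro A
  change A ∈ R
  rw [← Finset.univ_sum_single A]
  exact Submodule.sum_mem _ fun ν _ => key _ ν rfl _

/-- The group algebra of the symmetric group is the product of the endomorphism algebras of the
Specht modules. -/
def fourierEquiv (b : ℕ) :
    (Equiv.Perm (Fin b) → ℂ) ≃ₗ[ℂ] ∀ ν : Nat.Partition b,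
      Module.End ℂ (spechtSub ν).toSubmodule :=
  LinearEquiv.ofBijective (fourier specht)
    ⟨fourier_injective specht (card_conjClasses_perm_le b) (fourier_specht_surjective b),
      fourier_specht_surjective b⟩

/-- The regular bimodule of the symmetric group is the direct sum of the tensor squares of the
Specht modules. -/
def regularEquiv (b : ℕ) :
    (⨁ ν : Nat.Partition b, (spechtSub ν).toSubmodule ⊗[ℂ] (spechtSub ν).toSubmodule) ≃ₗ[ℂ]
      (Equiv.Perm (Fin b) → ℂ) :=
  DirectSum.linearEquivFunOnFintype ℂ _ _ ≪≫ₗ LinearEquiv.piCongrRight spechtEnd ≪≫ₗ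
    (fourierEquiv b).symm

/-- The first tensor factor carries left translation and the second carries right translation; the
direct sum statement rests on keeping the two apart. -/
theorem regularEquiv_lof (ν : Nat.Partition b) (g h : Equiv.Perm (Fin b))
    (u v : (spechtSub ν).toSubmodule) :
    regularEquiv b (DirectSum.lof ℂ _ _ ν (specht ν g u ⊗ₜ specht ν h v)) = fun k =>
      regularEquiv b (DirectSum.lof ℂ _ _ ν (u ⊗ₜ v)) (g⁻¹ * k * h) := by
  have key : ∀ z, fourier (specht (b := b)) (regularEquiv b (DirectSum.lof ℂ _ _ ν z)) =
      Pi.single ν (spechtEnd ν z) := by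
    intro z
    change fourierEquiv b ((fourierEquiv b).symm _) = _
    rw [LinearEquiv.apply_symm_apply]
    funext μ
    change spechtEnd μ (DirectSum.linearEquivFunOnFintype ℂ _
      (fun ν : Nat.Partition b => (spechtSub ν).toSubmodule ⊗[ℂ] (spechtSub ν).toSubmodule)
        (DirectSum.lof ℂ _ _ ν z) μ) = _
    rw [DirectSum.linearEquivFunOnFintype_lof]
    rcases eq_or_ne μ ν with rfl | hne
    · simp
    · simp [Pi.single_eq_of_ne hne]
  apply (fourierEquiv b).injective
  change fourier specht _ = fourier specht _
  funext μ
  rw [fourier_translate, key, key]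
  rcases eq_or_ne μ ν with rfl | hne
  · rw [Pi.single_eq_same, Pi.single_eq_same, spechtEnd_smul]
  · simp [Pi.single_eq_of_ne hne]

end SpechtTheory

/-! ### Ordered set partitions with one marked element in each block -/

section Wreath

/-- A permutation of the elements that moves whole blocks is a permutation of block numbers followed
by one inside each block. The block permutation p is given separately because for c = 0 it is not
determined by q. -/
theorem exists_wreathPerm_eq {c b : ℕ} (q : Equiv.Perm (Fin c × Fin b)) (p : Equiv.Perm (Fin b))
    (hq : ∀ z, (q z).2 = p z.2) : ∃ w : Wreath c b, w.right = p ∧ wreathPerm c b w = q := by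
  have hinj : ∀ j, Function.Injective fun x => (q (x, p⁻¹ j)).1 := by
    intro j x y hxy
    have : q (x, p⁻¹ j) = q (y, p⁻¹ j) := Prod.ext hxy ((hq (x, p⁻¹ j)).trans (hq (y, p⁻¹ j)).symm)
    exact congrArg Prod.fst (q.injective this)
  refine ⟨⟨fun j => Equiv.ofBijective _ (Finite.injective_iff_bijective.1 (hinj j)), p⟩, rfl, ?_⟩
  ext z : 1
  refine Prod.ext ?_ (hq z).symm
  change (q (z.1, p⁻¹ (p z.2))).1 = (q z).1
  rw [Equiv.Perm.coe_inv, Equiv.symm_apply_apply]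

theorem wreathHom_blockEquiv {a b : ℕ} (w : Wreath a b) (z : Fin a × Fin b) :
    wreathHom a b w (blockEquiv a b z) = blockEquiv a b (wreathPerm a b w z) := by
  change blockEquiv a b (wreathPerm a b w ((blockEquiv a b).symm (blockEquiv a b z))) = _
  rw [Equiv.symm_apply_apply]

variable {b c m : ℕ} (h : b + m = (c + 1) * b) (e : Fin c × Fin b ≃ Fin m)

/-- The identification of the disjoint union of the first `k` and the last `m` letters with all
letters. -/
def sumLetters {k n : ℕ} (h : k + m = n) : Fin k ⊕ Fin m ≃ Fin n :=
  finSumFinEquiv.trans (finCongr h)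

theorem youngHom_inl {k n : ℕ} (h : k + m = n) (p : Equiv.Perm (Fin k)) (q : Equiv.Perm (Fin m))
    (i : Fin k) : youngHom h (p, q) (sumLetters h (.inl i)) = sumLetters h (.inl (p i)) := by
  simp [youngHom, sumLetters]

theorem youngHom_inr {k n : ℕ} (h : k + m = n) (p : Equiv.Perm (Fin k)) (q : Equiv.Perm (Fin m))
    (j : Fin m) : youngHom h (p, q) (sumLetters h (.inr j)) = sumLetters h (.inr (q j)) := by
  simp [youngHom, sumLetters]

theorem sumLetters_inl_mem {k n : ℕ} (h : k + m = n) (i : Fin k) :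
    sumLetters h (.inl i) ∈ initial k n := by
  simp [initial, sumLetters]

theorem sumLetters_inr_notMem {k n : ℕ} (h : k + m = n) (j : Fin m) :
    sumLetters h (.inr j) ∉ initial k n := by
  simp [initial, sumLetters]

/-- The action of the wreath product on `b` blocks of size `c` that fill the last `m` letters. -/
def wreathAct : Wreath c b →* Equiv.Perm (Fin m) :=
  e.permCongrHom.toMonoidHom.comp (wreathPerm c b)

theorem wreathAct_apply (w : Wreath c b) (z : Fin c × Fin b) :
    wreathAct e w (e z) = e (wreathPerm c b w z) := by
  change e (wreathPerm c b w (e.symm (e z))) = _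
  rw [Equiv.symm_apply_apply]

/-- The identification of `b` blocks of size `c + 1` with `b` marked elements and `b` blocks of
size `c`. -/
def markEquiv : Fin (c + 1) × Fin b ≃ Fin b ⊕ Fin m where
  toFun z := Fin.cases (.inl z.2) (fun x => .inr (e (x, z.2))) z.1
  invFun s := Sum.elim (fun i => (0, i)) (fun j => ((e.symm j).1.succ, (e.symm j).2)) s
  left_inv := by
    rintro ⟨x, i⟩
    refine Fin.cases ?_ (fun x => ?_) x <;> simp
  right_inv := by
    rintro (i | j) <;> simp

@[simp] theorem markEquiv_zero (i : Fin b) : markEquiv e (0, i) = .inl i := rfl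

@[simp] theorem markEquiv_succ (x : Fin c) (i : Fin b) :
    markEquiv e (x.succ, i) = .inr (e (x, i)) := rfl

@[simp] theorem markEquiv_symm_inl (i : Fin b) : (markEquiv e).symm (.inl i) = (0, i) := rfl

@[simp] theorem markEquiv_symm_inr (j : Fin m) :
    (markEquiv e).symm (.inr j) = ((e.symm j).1.succ, (e.symm j).2) := rfl

/-- A permutation which moves the standard ordered set partition to one in which the block
number `i` contains the letter `i` as its only letter among the first `b` letters. -/
def markPerm : Equiv.Perm (Fin ((c + 1) * b)) :=
  (blockEquiv (c + 1) b).symm.trans ((markEquiv e).trans (sumLetters h))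

theorem markPerm_blockEquiv (z : Fin (c + 1) × Fin b) :
    markPerm h e (blockEquiv (c + 1) b z) = sumLetters h (markEquiv e z) := by
  simp [markPerm]

theorem perm_ext_blocks {a : ℕ} {f g : Equiv.Perm (Fin (a * b))}
    (hfg : ∀ z, f (blockEquiv a b z) = g (blockEquiv a b z)) : f = g := by
  refine Equiv.ext fun x => ?_
  obtain ⟨z, rfl⟩ := (blockEquiv a b).surjective x
  exact hfg z

/-- Moving marks and unmarked blocks by the same permutation of block numbers preserves the marked
set partition: one inclusion of the stabilizer computation. -/
theorem exists_youngHom_mul_markPerm (w : Wreath c b) :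
    ∃ v : Wreath (c + 1) b,
      youngHom h (w.right, wreathAct e w) * markPerm h e =
        markPerm h e * wreathHom (c + 1) b v := by
  have hQ : ∀ z, ((((markEquiv e).trans (Equiv.sumCongr w.right (wreathAct e w))).trans
      (markEquiv e).symm) z).2 = w.right z.2 := by
    rintro ⟨x, i⟩
    refine Fin.cases ?_ (fun x => ?_) x
    · simp
    · simp [wreathAct_apply, wreathPerm]
  obtain ⟨v, -, hv⟩ := exists_wreathPerm_eq _ w.right hQ
  refine ⟨v, perm_ext_blocks fun z => ?_⟩
  rw [Equiv.Perm.mul_apply, Equiv.Perm.mul_apply, wreathHom_blockEquiv, hv, markPerm_blockEquiv,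
    markPerm_blockEquiv]
  simp only [Equiv.trans_apply, Equiv.apply_symm_apply]
  cases markEquiv e z with
  | inl i => simp [youngHom_inl]
  | inr j => simp [youngHom_inr]

/-- The other inclusion: the marks show that the blocks are permuted by p, so q must permute the
unmarked blocks in the same way. -/
theorem exists_wreath_of_youngHom_mul_markPerm {p : Equiv.Perm (Fin b)} {q : Equiv.Perm (Fin m)}
    {v : Wreath (c + 1) b}
    (hv : youngHom h (p, q) * markPerm h e = markPerm h e * wreathHom (c + 1) b v) :
    ∃ w : Wreath c b, w.right = p ∧ wreathAct e w = q := by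
  have key : ∀ z, youngHom h (p, q) (sumLetters h (markEquiv e z)) =
      sumLetters h (markEquiv e (wreathPerm (c + 1) b v z)) := by
    intro z
    have := Equiv.congr_fun hv (blockEquiv (c + 1) b z)
    rwa [Equiv.Perm.mul_apply, Equiv.Perm.mul_apply, wreathHom_blockEquiv, markPerm_blockEquiv,
      markPerm_blockEquiv] at this
  have hp : ∀ i, v.right i = p i := by
    intro i
    have h1 := key (0, i)
    rw [markEquiv_zero, youngHom_inl, (sumLetters h).injective.eq_iff,
      ← Equiv.symm_apply_eq, markEquiv_symm_inl] at h1
    exact (congrArg Prod.snd h1).symm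
  have hq : ∀ z, (e.symm (q (e z))).2 = p z.2 := by
    rintro ⟨x, i⟩
    have h1 := key (x.succ, i)
    rw [markEquiv_succ, youngHom_inr, (sumLetters h).injective.eq_iff,
      ← Equiv.symm_apply_eq, markEquiv_symm_inr] at h1
    exact (congrArg Prod.snd h1).trans (hp i)
  obtain ⟨w, hw, hwq⟩ := exists_wreathPerm_eq ((e.trans q).trans e.symm) p hq
  refine ⟨w, hw, Equiv.ext fun j => ?_⟩
  obtain ⟨z, rfl⟩ := e.surjective j
  rw [wreathAct_apply, hwq]
  simp

theorem traceType_markPerm : traceType (c + 1) b (markPerm h e) = (ones b).parts := by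
  have hcard : ∀ i, (block (c + 1) (markPerm h e) i ∩ initial b ((c + 1) * b)).card = 1 := by
    intro i
    rw [Finset.card_eq_one]
    refine ⟨sumLetters h (.inl i), ?_⟩
    ext y
    simp only [block, Finset.mem_inter, Finset.mem_image, Finset.mem_univ, true_and,
      Finset.mem_singleton, markPerm_blockEquiv]
    constructor
    · rintro ⟨⟨x, rfl⟩, hy⟩
      revert hy
      refine Fin.cases (fun _ => rfl) (fun x hy => ?_) x
      exact absurd hy (sumLetters_inr_notMem h _)
    · rintro rfl
      exact ⟨⟨0, rfl⟩, sumLetters_inl_mem h i⟩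
  unfold traceType
  simp only [hcard, Multiset.map_const']
  rw [Multiset.filter_eq_self.2 fun x hx => by
    rw [Multiset.eq_of_mem_replicate hx]; exact one_ne_zero]
  simp [ones]

theorem card_block_inter_initial_eq_one {a : ℕ} {g : Equiv.Perm (Fin (a * b))}
    (hg : traceType a b g = (ones b).parts) (i : Fin b) :
    (block a g i ∩ initial b (a * b)).card = 1 := by
  unfold traceType at hg
  -- There are b blocks and b nonzero sizes, so the filter discards nothing.
  have h1 := Multiset.eq_of_le_of_card_le
    (Multiset.filter_le (· ≠ 0) (Finset.univ.val.map fun i : Fin b =>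
      (block a g i ∩ initial b (a * b)).card)) (by rw [hg]; simp [ones])
  rw [hg] at h1
  have h2 : (block a g i ∩ initial b (a * b)).card ∈ (ones b).parts := by
    rw [h1]
    exact Multiset.mem_map_of_mem _ (Finset.mem_univ i)
  exact Multiset.eq_of_mem_replicate h2

/-- Transitivity: once a wreath element brings the mark of each block to position 0, the permutation
that remains maps the first b letters to themselves and so lies in S_b × S_m. -/
theorem exists_eq_youngHom_mul_markPerm {g : Equiv.Perm (Fin ((c + 1) * b))}
    (hg : traceType (c + 1) b g = (ones b).parts) :
    ∃ p q v, g = youngHom h (p, q) * markPerm h e * wreathHom (c + 1) b v := by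
  have hx : ∀ i, ∃ x, g (blockEquiv (c + 1) b (x, i)) ∈ initial b ((c + 1) * b) := by
    intro i
    have h1 := card_block_inter_initial_eq_one hg i
    obtain ⟨y, hy⟩ := Finset.card_pos.1 (h1.symm ▸ one_pos)
    obtain ⟨h2, h3⟩ := Finset.mem_inter.1 hy
    obtain ⟨x, -, rfl⟩ := Finset.mem_image.1 h2
    exact ⟨x, h3⟩
  choose x hx using hx
  let v : Wreath (c + 1) b := ⟨fun i => Equiv.swap 0 (x i), 1⟩
  have hv : ∀ i, wreathPerm (c + 1) b v (0, i) = (x i, i) := fun i =>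
    Prod.ext (Equiv.swap_apply_left _ _) rfl
  let s : Equiv.Perm (Fin b ⊕ Fin m) := ((sumLetters h).trans
    (g * wreathHom (c + 1) b v * (markPerm h e)⁻¹)).trans (sumLetters h).symm
  have hs : s ∈ (Equiv.Perm.sumCongrHom (Fin b) (Fin m)).range := by
    refine Equiv.Perm.mem_sumCongrHom_range_of_perm_mapsTo_inl ?_
    rintro _ ⟨i, rfl⟩
    have h1 : (markPerm h e)⁻¹ (sumLetters h (.inl i)) = blockEquiv (c + 1) b (0, i) := by
      rw [Equiv.Perm.inv_eq_iff_eq, markPerm_blockEquiv, markEquiv_zero]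
    have h2 : s (.inl i) = (sumLetters h).symm (g (blockEquiv (c + 1) b (x i, i))) := by
      simp only [s, Equiv.trans_apply, Equiv.Perm.mul_apply, h1, wreathHom_blockEquiv, hv]
    rw [h2]
    have h3 := hx i
    rw [← (sumLetters h).apply_symm_apply (g _)] at h3
    cases h4 : (sumLetters h).symm (g (blockEquiv (c + 1) b (x i, i))) with
    | inl k => exact ⟨k, rfl⟩
    | inr j =>
      rw [h4] at h3
      exact absurd h3 (sumLetters_inr_notMem h j)
  obtain ⟨⟨p, q⟩, hpq⟩ := hs
  refine ⟨p, q, v⁻¹, ?_⟩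
  have : youngHom h (p, q) = g * wreathHom (c + 1) b v * (markPerm h e)⁻¹ := by
    refine Equiv.ext fun y => ?_
    change sumLetters h (Equiv.Perm.sumCongrHom _ _ (p, q) ((sumLetters h).symm y)) = _
    rw [hpq]
    simp [s]
  rw [this, map_inv]
  group

end Wreath

/-! ### Maps out of induced representations -/

section Induced

variable {G H A W : Type*} [Group G] [Group H] (φ : G →* H) [AddCommGroup A] [Module ℂ A]
  (ρ : Representation ℂ G A) [AddCommMonoid W] [Module ℂ W]

theorem indV_mk_smul (g : G) (x : H) (v : A) :
    Representation.IndV.mk φ ρ (φ g * x) (ρ g v) = Representation.IndV.mk φ ρ x v := by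
  have := Representation.Coinvariants.mk_self_apply
    (Representation.tprod ((Representation.leftRegular ℂ H).comp φ) ρ) g
    (MonoidAlgebra.single x 1 ⊗ₜ v)
  simpa using this

/-- The linear map out of an induced module given by a compatible family of linear maps. -/
def indVLift (f : H → A →ₗ[ℂ] W) (hf : ∀ g x v, f (φ g * x) (ρ g v) = f x v) :
    Representation.IndV φ ρ →ₗ[ℂ] W :=
  letI : AddCommGroup W := Module.addCommMonoidToAddCommGroup ℂ
  Representation.Coinvariants.lift _
    (TensorProduct.lift ((Finsupp.lift _ ℂ H f) ∘ₗ
      (MonoidAlgebra.coeffLinearEquiv ℂ).toLinearMap)) fun g => by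
    ext x v
    simp [hf]

@[simp]
theorem indVLift_mk (f : H → A →ₗ[ℂ] W) (hf : ∀ g x v, f (φ g * x) (ρ g v) = f x v) (x : H)
    (v : A) : indVLift φ ρ f hf (Representation.IndV.mk φ ρ x v) = f x v := by
  simp [indVLift]

end Induced

/-! ### The trivial Specht module -/

section Trivial

variable {b : ℕ}

instance (b : ℕ) : Subsingleton (Tabloid (Nat.Partition.indiscrete b)) := by
  refine ⟨fun S T => ?_⟩
  obtain ⟨s, rfl⟩ := S.exists_rep
  obtain ⟨t, rfl⟩ := T.exists_rep
  have key : ∀ (t : Tableau (Nat.Partition.indiscrete b)) x, t.row x = 0 := by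
    intro t x
    have hb : b ≠ 0 := by rintro rfl; exact x.elim0
    have h1 := YoungDiagram.mem_iff_lt_colLen.1 (t.mem_shape x)
    have h2 := (shape (Nat.Partition.indiscrete b)).colLen_anti 0 (t.col x) (Nat.zero_le _)
    rw [← YoungDiagram.length_rowLens, rowLens_shape, Multiset.length_sort,
      Nat.Partition.indiscrete_parts hb, Multiset.card_singleton] at h2
    omega
  rw [Tableau.tabloid_eq_iff]
  intro x
  rw [key, key]

theorem specht_indiscrete (σ : Equiv.Perm (Fin b))
    (v : (spechtSub (Nat.Partition.indiscrete b)).toSubmodule) :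
    specht (Nat.Partition.indiscrete b) σ v = v := by
  refine Subtype.ext (tabloid_ext fun T => ?_)
  change (Representation.ofMulAction ℂ _ (Tabloid (Nat.Partition.indiscrete b)) σ v.1).coeff T = _
  rw [Representation.coeff_ofMulAction, Subsingleton.elim (σ⁻¹ • T) T]

theorem coeff_spechtVec_indiscrete (t : Tableau (Nat.Partition.indiscrete b))
    (T : Tabloid (Nat.Partition.indiscrete b)) : (spechtVec t).1.coeff T = 1 := by
  rw [Subsingleton.elim T t.tabloid]
  exact coeff_polytabloid_self t

theorem spechtVec_indiscrete (s t : Tableau (Nat.Partition.indiscrete b)) :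
    spechtVec s = spechtVec t :=
  Subtype.ext (tabloid_ext fun T => by
    rw [coeff_spechtVec_indiscrete, coeff_spechtVec_indiscrete])

/-- The Specht module of (b) is trivial, so the vector depends only on the coset of g, that is, on
the unordered set partition. -/
theorem foulkesVec_indiscrete (a : ℕ) (g : Equiv.Perm (Fin (a * b))) (w : Wreath a b)
    (s t : Tableau (Nat.Partition.indiscrete b)) :
    foulkesVec a _ (g * wreathHom a b w) s = foulkesVec a _ g t := by
  unfold foulkesVec
  rw [← indV_mk_smul _ _ w⁻¹ g⁻¹, mul_inv_rev, map_inv]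
  congr 1
  exact (spechtVec_indiscrete s t).trans (specht_indiscrete _ _).symm

end Trivial

/-! ### The summand of type `(1^b)` -/

section Main

variable {b c m : ℕ} (h : b + m = (c + 1) * b) (e : Fin c × Fin b ≃ Fin m)

/-- The vector of the Foulkes module that belongs to the set partition with one marked element
in each block which is the image of the standard one under `p`. -/
def markVec (p : Equiv.Perm (Fin b) × Equiv.Perm (Fin m)) :
    (component h (Nat.Partition.indiscrete b) (ones b)).toSubmodule :=
  ⟨foulkesVec (c + 1) _ (youngHom h p * markPerm h e) (Classical.arbitrary _),
    Submodule.subset_span ⟨_, _, by rw [traceType_youngHom, traceType_markPerm], rfl⟩⟩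

theorem U_markVec (p q : Equiv.Perm (Fin b) × Equiv.Perm (Fin m)) :
    U h (Nat.Partition.indiscrete b) p (markVec h e q) = markVec h e (p * q) := by
  refine Subtype.ext ?_
  change foulkes (c + 1) _ (youngHom h p) (foulkesVec (c + 1) _ _ _) = foulkesVec _ _ _ _
  rw [foulkes_foulkesVec, map_mul, mul_assoc]

/-- Stabilizer elements on the right do not change the set partition. -/
theorem markVec_mul_wreath (p : Equiv.Perm (Fin b) × Equiv.Perm (Fin m)) (w : Wreath c b) :
    markVec h e (p * (w.right, wreathAct e w)) = markVec h e p := by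
  obtain ⟨v, hv⟩ := exists_youngHom_mul_markPerm h e w
  refine Subtype.ext ?_
  change foulkesVec _ _ _ _ = foulkesVec _ _ _ _
  rw [map_mul, mul_assoc, hv, ← mul_assoc]
  exact foulkesVec_indiscrete _ _ _ _ _

theorem span_markVec : Submodule.span ℂ (Set.range (markVec h e)) = ⊤ := by
  rw [eq_top_iff]
  rintro ⟨x, hx⟩ -
  have key : (component h (Nat.Partition.indiscrete b) (ones b)).toSubmodule ≤
      Submodule.map (component h (Nat.Partition.indiscrete b) (ones b)).toSubmodule.subtype
        (Submodule.span ℂ (Set.range (markVec h e))) := by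
    refine Submodule.span_le.2 ?_
    rintro _ ⟨g, t, hg, rfl⟩
    obtain ⟨p, q, v, rfl⟩ := exists_eq_youngHom_mul_markPerm h e hg
    exact ⟨markVec h e (p, q), Submodule.subset_span ⟨_, rfl⟩,
      (foulkesVec_indiscrete _ _ _ _ _).symm⟩
  obtain ⟨y, hy, hyx⟩ := key hx
  rwa [show (⟨x, hx⟩ : (component h (Nat.Partition.indiscrete b) (ones b)).toSubmodule) = y from
    Subtype.ext hyx.symm]

/-! ### The map from the direct sum onto the summand -/

/-- The underlying space of the Foulkes module of `ν` for blocks that fill the last letters. -/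
abbrev BlockFoulkesV (ν : Nat.Partition b) : Type :=
  Representation.IndV (wreathAct e) (inflSpecht c ν)

/-- The Foulkes module of `ν` for blocks that fill the last letters. -/
abbrev blockFoulkes (ν : Nat.Partition b) :
    Representation ℂ (Equiv.Perm (Fin m)) (BlockFoulkesV e ν) :=
  Representation.ind (wreathAct e) (inflSpecht c ν)

/-- The combination of the vectors `markVec (σ, q)` with given coefficients. -/
def markSum (q : Equiv.Perm (Fin m)) : (Equiv.Perm (Fin b) → ℂ) →ₗ[ℂ]
    (component h (Nat.Partition.indiscrete b) (ones b)).toSubmodule :=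
  ∑ σ, (LinearMap.proj σ).smulRight (markVec h e (σ, q))

theorem markSum_apply (q : Equiv.Perm (Fin m)) (x : Equiv.Perm (Fin b) → ℂ) :
    markSum h e q x = ∑ σ, x σ • markVec h e (σ, q) := by
  simp [markSum, LinearMap.sum_apply]

theorem markSum_translate (p : Equiv.Perm (Fin b)) (q r : Equiv.Perm (Fin m))
    (x : Equiv.Perm (Fin b) → ℂ) :
    markSum h e (q * r) (fun k => x (p⁻¹ * k)) =
      U h (Nat.Partition.indiscrete b) (p, q) (markSum h e r x) := by
  rw [markSum_apply, markSum_apply, map_sum]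
  refine Fintype.sum_equiv (Equiv.mulLeft p⁻¹) _ _ fun k => ?_
  rw [map_smul, U_markVec]
  simp

theorem markSum_wreath (q : Equiv.Perm (Fin m)) (w : Wreath c b) (x : Equiv.Perm (Fin b) → ℂ) :
    markSum h e (q * (wreathAct e w)⁻¹) (fun k => x (k * w.right)) = markSum h e q x := by
  rw [markSum_apply, markSum_apply]
  refine Fintype.sum_equiv (Equiv.mulRight w.right) _ _ fun k => ?_
  rw [← markVec_mul_wreath h e _ w]
  simp

/-- The bilinear map `(v, u) ↦ ∑ σ, x σ • markVec (σ, q)`, where `x` is the matrix coefficient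
that corresponds to `u ⊗ v`. -/
def markBilin (q : Equiv.Perm (Fin m)) (ν : Nat.Partition b) :
    (spechtSub ν).toSubmodule →ₗ[ℂ] (spechtSub ν).toSubmodule →ₗ[ℂ]
      (component h (Nat.Partition.indiscrete b) (ones b)).toSubmodule :=
  (TensorProduct.mk ℂ (spechtSub ν).toSubmodule (spechtSub ν).toSubmodule).flip.compr₂
    (markSum h e q ∘ₗ (regularEquiv b).toLinearMap ∘ₗ DirectSum.lof ℂ (Nat.Partition b)
      (fun ν => (spechtSub ν).toSubmodule ⊗[ℂ] (spechtSub ν).toSubmodule) ν)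

theorem markBilin_apply (q : Equiv.Perm (Fin m)) (ν : Nat.Partition b)
    (u v : (spechtSub ν).toSubmodule) :
    markBilin h e q ν v u =
      markSum h e q (regularEquiv b (DirectSum.lof ℂ _ _ ν (u ⊗ₜ v))) := rfl

/-- This lets the map descend to the induced module. Acting on v translates the coefficient function
on the right by `w.right`, and the wreath invariance of `markVec` absorbs this together with the
change of k. -/
theorem markBilin_wreath (k : Equiv.Perm (Fin m)) (ν : Nat.Partition b) (w : Wreath c b)
    (v : (spechtSub ν).toSubmodule) :
    markBilin h e (wreathAct e w * k)⁻¹ ν (inflSpecht c ν w v) = markBilin h e k⁻¹ ν v := by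
  refine LinearMap.ext fun u => ?_
  have h0 : inflSpecht c ν w v = specht ν w.right v := rfl
  have h1 := regularEquiv_lof ν 1 w.right u v
  rw [map_one, Module.End.one_apply] at h1
  rw [h0, markBilin_apply, markBilin_apply, h1, mul_inv_rev,
    ← markSum_wreath h e _ w (regularEquiv b _)]
  simp only [inv_one, one_mul]

/-- The component at `ν` of the map from the direct sum to the summand of type `(1^b)`. -/
def toSummandAux (ν : Nat.Partition b) : BlockFoulkesV e ν →ₗ[ℂ] (spechtSub ν).toSubmodule →ₗ[ℂ]
    (component h (Nat.Partition.indiscrete b) (ones b)).toSubmodule :=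
  indVLift _ _ (fun k => markBilin h e k⁻¹ ν) fun w k v => markBilin_wreath h e k ν w v

theorem toSummandAux_mk (ν : Nat.Partition b) (k : Equiv.Perm (Fin m))
    (u v : (spechtSub ν).toSubmodule) :
    toSummandAux h e ν (Representation.IndV.mk _ _ k v) u =
      markSum h e k⁻¹ (regularEquiv b (DirectSum.lof ℂ _ _ ν (u ⊗ₜ v))) := by
  rw [toSummandAux, indVLift_mk, markBilin_apply]

/-- The map from the direct sum to the summand of type `(1^b)`. -/
def toSummand : (⨁ ν : Nat.Partition b, (spechtSub ν).toSubmodule ⊗[ℂ] BlockFoulkesV e ν) →ₗ[ℂ]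
    (component h (Nat.Partition.indiscrete b) (ones b)).toSubmodule :=
  DirectSum.toModule ℂ _ _ fun ν => TensorProduct.lift (toSummandAux h e ν).flip

theorem toSummand_lof (ν : Nat.Partition b) (k : Equiv.Perm (Fin m))
    (u v : (spechtSub ν).toSubmodule) :
    toSummand h e (DirectSum.lof ℂ _ _ ν (u ⊗ₜ Representation.IndV.mk _ _ k v)) =
      markSum h e k⁻¹ (regularEquiv b (DirectSum.lof ℂ _ _ ν (u ⊗ₜ v))) := by
  rw [toSummand, DirectSum.toModule_lof, TensorProduct.lift.tmul, LinearMap.flip_apply,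
    toSummandAux_mk]

theorem directSum_tmul_hom_ext {W : Type*} [AddCommMonoid W] [Module ℂ W]
    {f g : (⨁ ν : Nat.Partition b, (spechtSub ν).toSubmodule ⊗[ℂ] BlockFoulkesV e ν) →ₗ[ℂ] W}
    (hfg : ∀ ν k (u v : (spechtSub ν).toSubmodule),
      f (DirectSum.lof ℂ _ _ ν (u ⊗ₜ Representation.IndV.mk _ _ k v)) =
      g (DirectSum.lof ℂ _ _ ν (u ⊗ₜ Representation.IndV.mk _ _ k v))) : f = g := by
  let _ : AddCommGroup W := Module.addCommMonoidToAddCommGroup ℂ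
  refine DirectSum.linearMap_ext ℂ fun ν => TensorProduct.ext ?_
  refine LinearMap.ext fun u => Representation.IndV.hom_ext _ _ fun k => LinearMap.ext fun v => ?_
  exact hfg ν k u v

theorem toSummand_equivariant (p : Equiv.Perm (Fin b) × Equiv.Perm (Fin m)) :
    toSummand h e ∘ₗ Representation.directSum (fun ν : Nat.Partition b =>
      extTensor (specht ν) (blockFoulkes e ν)) p =
        U h (Nat.Partition.indiscrete b) p ∘ₗ toSummand h e := by
  obtain ⟨p, q⟩ := p
  refine directSum_tmul_hom_ext e fun ν k u v => ?_
  have h1 : Representation.directSum (fun ν : Nat.Partition b =>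
      extTensor (specht ν) (blockFoulkes e ν)) (p, q)
        (DirectSum.lof ℂ _ _ ν (u ⊗ₜ Representation.IndV.mk _ _ k v)) =
      DirectSum.lof ℂ _ _ ν (specht ν p u ⊗ₜ Representation.IndV.mk _ _ (k * q⁻¹) v) := by
    change DirectSum.lmap _ _ = _
    rw [DirectSum.lmap_lof, ← Representation.ind_mk]
    rfl
  refine (congrArg (toSummand h e) h1).trans (Eq.trans ?_
    (congrArg (U h (Nat.Partition.indiscrete b) (p, q)) (toSummand_lof h e ν k u v)).symm)
  rw [toSummand_lof, ← markSum_translate, mul_inv_rev, inv_inv]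
  have h2 := regularEquiv_lof ν p 1 u v
  rw [map_one, Module.End.one_apply] at h2
  rw [h2]
  simp only [mul_one]

/-- The map of direct sums induced by `v ↦ q ⊗ v`. -/
def tensorMk (q : Equiv.Perm (Fin m)) :
    (⨁ ν : Nat.Partition b, (spechtSub ν).toSubmodule ⊗[ℂ] (spechtSub ν).toSubmodule) →ₗ[ℂ]
      ⨁ ν : Nat.Partition b, (spechtSub ν).toSubmodule ⊗[ℂ] BlockFoulkesV e ν :=
  DirectSum.lmap fun _ => LinearMap.lTensor _ (Representation.IndV.mk _ _ q⁻¹)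

theorem tensorMk_lof (q : Equiv.Perm (Fin m)) (ν : Nat.Partition b)
    (u v : (spechtSub ν).toSubmodule) :
    tensorMk e q (DirectSum.lof ℂ _ _ ν (u ⊗ₜ v)) =
      DirectSum.lof ℂ _ _ ν (u ⊗ₜ Representation.IndV.mk _ _ q⁻¹ v) := by
  rw [tensorMk, DirectSum.lmap_lof]
  rfl

theorem toSummand_tensorMk (q : Equiv.Perm (Fin m)) (z) :
    toSummand h e (tensorMk e q z) = markSum h e q (regularEquiv b z) := by
  suffices hs : toSummand h e ∘ₗ tensorMk e q = markSum h e q ∘ₗ (regularEquiv b).toLinearMap from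
    LinearMap.congr_fun hs z
  refine DirectSum.linearMap_ext ℂ fun ν => TensorProduct.ext' fun u v => ?_
  change toSummand h e (tensorMk e q (DirectSum.lof ℂ _ _ ν (u ⊗ₜ v))) =
    markSum h e q (regularEquiv b (DirectSum.lof ℂ _ _ ν (u ⊗ₜ v)))
  rw [tensorMk_lof, toSummand_lof, inv_inv]

theorem toSummand_surjective : Function.Surjective (toSummand h e) := by
  classical
  rw [← LinearMap.range_eq_top, eq_top_iff, ← span_markVec h e, Submodule.span_le]
  rintro _ ⟨⟨p, q⟩, rfl⟩
  -- The preimage comes from the delta function at p, which selects one term of the sum.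
  refine ⟨tensorMk e q ((regularEquiv b).symm (Pi.single p 1)), ?_⟩
  rw [toSummand_tensorMk, LinearEquiv.apply_symm_apply, markSum_apply,
    Finset.sum_eq_single p (fun σ _ hσ => by simp [Pi.single_eq_of_ne hσ]) (by simp)]
  simp

/-! ### The left inverse -/

/-- The element of the direct sum that corresponds to `markVec p`. -/
def ofMark (p : Equiv.Perm (Fin b) × Equiv.Perm (Fin m)) :
    ⨁ ν : Nat.Partition b, (spechtSub ν).toSubmodule ⊗[ℂ] BlockFoulkesV e ν :=
  open Classical in tensorMk e p.2 ((regularEquiv b).symm (Pi.single p.1 1))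

theorem ofMark_mul_wreath (p : Equiv.Perm (Fin b) × Equiv.Perm (Fin m)) (w : Wreath c b) :
    ofMark e (p * (w.right, wreathAct e w)) = ofMark e p := by
  classical
  obtain ⟨p, q⟩ := p
  -- On the direct sum, `R` is right translation of functions on S_b by `w.right`, transported
  -- through `regularEquiv`.
  let R : (⨁ ν : Nat.Partition b, (spechtSub ν).toSubmodule ⊗[ℂ] (spechtSub ν).toSubmodule) →ₗ[ℂ]
      ⨁ ν : Nat.Partition b, (spechtSub ν).toSubmodule ⊗[ℂ] (spechtSub ν).toSubmodule :=
    DirectSum.lmap fun ν => LinearMap.lTensor _ (specht ν w.right⁻¹)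
  have hR : ∀ ν (u v : (spechtSub ν).toSubmodule), R (DirectSum.lof ℂ _ _ ν (u ⊗ₜ v)) =
      DirectSum.lof ℂ _ _ ν (u ⊗ₜ specht ν w.right⁻¹ v) := by
    intro ν u v
    rw [DirectSum.lmap_lof]
    rfl
  have h1 : (regularEquiv b).toLinearMap ∘ₗ R =
      LinearMap.funLeft ℂ ℂ (fun k => k * w.right⁻¹) ∘ₗ (regularEquiv b).toLinearMap := by
    refine DirectSum.linearMap_ext ℂ fun ν => TensorProduct.ext' fun u v => ?_
    have h2 := regularEquiv_lof ν 1 w.right⁻¹ u v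
    rw [map_one, Module.End.one_apply] at h2
    change regularEquiv b (R (DirectSum.lof ℂ _ _ ν (u ⊗ₜ v))) = _
    rw [hR, h2]
    funext k
    rw [inv_one, one_mul]
    rfl
  have h3 : tensorMk e (q * wreathAct e w) ∘ₗ R = tensorMk e q := by
    refine DirectSum.linearMap_ext ℂ fun ν => TensorProduct.ext' fun u v => ?_
    change tensorMk e _ (R (DirectSum.lof ℂ _ _ ν (u ⊗ₜ v))) =
      tensorMk e q (DirectSum.lof ℂ _ _ ν (u ⊗ₜ v))
    rw [hR, tensorMk_lof, tensorMk_lof, ← indV_mk_smul _ _ w⁻¹ q⁻¹, mul_inv_rev,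
      map_inv (wreathAct e)]
    rfl
  change tensorMk e (q * wreathAct e w) ((regularEquiv b).symm (Pi.single (p * w.right) 1)) =
    tensorMk e q ((regularEquiv b).symm (Pi.single p 1))
  have h4 : (regularEquiv b).symm (Pi.single (p * w.right) 1) =
      R ((regularEquiv b).symm (Pi.single p 1)) := by
    rw [LinearEquiv.symm_apply_eq]
    have h5 := LinearMap.congr_fun h1 ((regularEquiv b).symm (Pi.single p 1))
    simp only [LinearMap.comp_apply, LinearEquiv.coe_coe, LinearEquiv.apply_symm_apply] at h5
    rw [h5]
    funext k
    simp [LinearMap.funLeft_apply, Pi.single_apply, mul_inv_eq_iff_eq_mul]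
  rw [h4]
  exact LinearMap.congr_fun h3 _

open Classical in
/-- The element of the direct sum that corresponds to an ordered set partition, if this has one
marked element in each block, and zero otherwise. -/
def ofPerm (g : Equiv.Perm (Fin ((c + 1) * b))) :
    ⨁ ν : Nat.Partition b, (spechtSub ν).toSubmodule ⊗[ℂ] BlockFoulkesV e ν :=
  if hg : ∃ p v, g = youngHom h p * markPerm h e * wreathHom (c + 1) b v then
    ofMark e hg.choose else 0

/-- Two representations of the same permutation have Young parts differing by a stabilizer element,
and `ofMark` does not see it; hence the choice is harmless. -/
theorem ofPerm_eq (p : Equiv.Perm (Fin b) × Equiv.Perm (Fin m)) (v : Wreath (c + 1) b) :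
    ofPerm h e (youngHom h p * markPerm h e * wreathHom (c + 1) b v) = ofMark e p := by
  have hg : ∃ p' v', youngHom h p * markPerm h e * wreathHom (c + 1) b v =
      youngHom h p' * markPerm h e * wreathHom (c + 1) b v' := ⟨p, v, rfl⟩
  rw [ofPerm, dif_pos hg]
  obtain ⟨v', hv'⟩ := hg.choose_spec
  generalize hg.choose = p' at hv'
  have h1 : youngHom h (p⁻¹ * p') * markPerm h e =
      markPerm h e * wreathHom (c + 1) b (v * v'⁻¹) := by
    rw [map_mul, map_mul, map_inv, map_inv, mul_assoc, inv_mul_eq_iff_eq_mul, ← mul_assoc,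
      ← mul_assoc, hv', mul_inv_cancel_right]
  obtain ⟨w, hw1, hw2⟩ := exists_wreath_of_youngHom_mul_markPerm h e (p := (p⁻¹ * p').1)
    (q := (p⁻¹ * p').2) h1
  have h2 : p' = p * (w.right, wreathAct e w) := by
    rw [hw1, hw2, Prod.mk.eta, mul_inv_cancel_left]
  rw [h2, ofMark_mul_wreath]

theorem ofPerm_mul_wreathHom (g : Equiv.Perm (Fin ((c + 1) * b))) (v : Wreath (c + 1) b) :
    ofPerm h e (g * wreathHom (c + 1) b v) = ofPerm h e g := by
  by_cases hg : ∃ p v', g = youngHom h p * markPerm h e * wreathHom (c + 1) b v'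
  · obtain ⟨p, v', rfl⟩ := hg
    rw [mul_assoc, ← map_mul, ofPerm_eq, ofPerm_eq]
  · rw [ofPerm, ofPerm, dif_neg hg, dif_neg]
    rintro ⟨p, v', hv⟩
    refine hg ⟨p, v' * v⁻¹, ?_⟩
    rw [map_mul, map_inv, ← mul_assoc, ← hv, mul_inv_cancel_right]

/-- The map from the ordinary Foulkes module to the direct sum. -/
def fromFoulkes : FoulkesV (c + 1) (Nat.Partition.indiscrete b) →ₗ[ℂ]
    ⨁ ν : Nat.Partition b, (spechtSub ν).toSubmodule ⊗[ℂ] BlockFoulkesV e ν :=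
  -- Pairing with a polytabloid identifies the trivial Specht module with ℂ. Using the whole Foulkes
  -- module, with zero on the other set partitions, avoids having to show that the spanning vectors
  -- of the summand satisfy no further relations.
  indVLift _ _ (fun g => (spechtDual _ (spechtVec (Classical.arbitrary _))).smulRight
    (ofPerm h e g⁻¹)) fun w g v => by
    rw [mul_inv_rev, ← map_inv]
    simp only [LinearMap.smulRight_apply]
    rw [ofPerm_mul_wreathHom]
    congr 2
    exact specht_indiscrete w.right v

theorem fromFoulkes_markVec (p : Equiv.Perm (Fin b) × Equiv.Perm (Fin m)) :
    fromFoulkes h e (markVec h e p).1 = ofMark e p := by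
  classical
  have hone : spechtDual (Nat.Partition.indiscrete b) (spechtVec (Classical.arbitrary _))
      (spechtVec (Classical.arbitrary _)) = 1 := by
    rw [spechtDual_apply, tabloidForm_apply]
    simp only [coeff_spechtVec_indiscrete]
    have : Fintype.card (Tabloid (Nat.Partition.indiscrete b)) = 1 :=
      Fintype.card_eq_one_iff.2 ⟨(Classical.arbitrary (Tableau _)).tabloid,
        fun _ => Subsingleton.elim _ _⟩
    simp [this]
  have h1 := ofPerm_eq h e p 1
  rw [map_one, mul_one] at h1
  unfold fromFoulkes markVec foulkesVec
  rw [indVLift_mk, LinearMap.smulRight_apply, hone, inv_inv, one_smul, h1]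

theorem fromFoulkes_toSummand (z) : fromFoulkes h e (toSummand h e z).1 = z := by
  classical
  suffices hs : fromFoulkes h e ∘ₗ Submodule.subtype _ ∘ₗ toSummand h e = LinearMap.id from
    LinearMap.congr_fun hs z
  refine directSum_tmul_hom_ext e fun ν k u v => ?_
  change fromFoulkes h e (toSummand h e _).1 = DirectSum.lof ℂ _ _ ν _
  -- Expanding x in delta functions reduces the claim to the vectors `markVec`.
  have h1 : ∀ x, fromFoulkes h e (markSum h e k⁻¹ x).1 =
      tensorMk e k⁻¹ ((regularEquiv b).symm x) := by
    intro x
    rw [markSum_apply, Submodule.coe_sum, map_sum]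
    conv_rhs => rw [← Finset.univ_sum_single x]
    rw [map_sum, map_sum]
    refine Finset.sum_congr rfl fun σ _ => ?_
    rw [Submodule.coe_smul, map_smul, fromFoulkes_markVec, ofMark, ← map_smul, ← map_smul]
    congr 2
    rw [← Pi.single_smul, smul_eq_mul, mul_one]
  rw [toSummand_lof, h1, LinearEquiv.symm_apply_apply, tensorMk_lof, inv_inv]

/-- The summand of type `(1^b)` of the ordinary Foulkes module is the direct sum of the external
tensor products of Specht modules with generalized Foulkes modules. -/
def summandEquiv : (U h (Nat.Partition.indiscrete b)).Equiv
    (Representation.directSum fun ν : Nat.Partition b =>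
      extTensor (specht ν) (blockFoulkes e ν)) :=
  (Representation.Equiv.mk (LinearEquiv.ofBijective (toSummand h e)
    ⟨Function.LeftInverse.injective (g := fun x :
      (component h (Nat.Partition.indiscrete b) (ones b)).toSubmodule => fromFoulkes h e x.1)
        (fromFoulkes_toSummand h e), toSummand_surjective h e⟩) (toSummand_equivariant h e)).symm

end Main

/-! ### Blocks of size one -/

section Congruence

variable {G H : Type} [Group G] [Group H] {ι : Type} {V W W' : ι → Type}
  [∀ i, AddCommGroup (V i)] [∀ i, Module ℂ (V i)] [∀ i, AddCommGroup (W i)] [∀ i, Module ℂ (W i)]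
  [∀ i, AddCommGroup (W' i)] [∀ i, Module ℂ (W' i)] (ρ : ∀ i, Representation ℂ G (V i))
  {τ : ∀ i, Representation ℂ H (W i)} {τ' : ∀ i, Representation ℂ H (W' i)}

/-- Equivalences of the second factors induce an equivalence of direct sums of external tensor
products. -/
def directSumExtTensorCongr (f : ∀ i, (τ i).Equiv (τ' i)) :
    (Representation.directSum fun i => extTensor (ρ i) (τ i)).Equiv
      (Representation.directSum fun i => extTensor (ρ i) (τ' i)) :=
  Representation.Equiv.mk
    (DFinsupp.mapRange.linearEquiv fun i =>
      TensorProduct.congr (LinearEquiv.refl ℂ (V i)) (f i).toLinearEquiv) fun g => by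
    classical
    refine DirectSum.linearMap_ext ℂ fun i => TensorProduct.ext' fun v w => ?_
    have hL : ∀ v w, (DFinsupp.mapRange.linearEquiv fun i =>
        TensorProduct.congr (LinearEquiv.refl ℂ (V i)) (f i).toLinearEquiv)
          (DirectSum.lof ℂ ι (fun i => V i ⊗[ℂ] W i) i (v ⊗ₜ w)) =
        DirectSum.lof ℂ ι (fun i => V i ⊗[ℂ] W' i) i (v ⊗ₜ f i w) := fun v w =>
      DFinsupp.mapRange_single (hf := fun _ => map_zero _)
    have hR : Representation.directSum (fun i => extTensor (ρ i) (τ i)) g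
        (DirectSum.lof ℂ ι (fun i => V i ⊗[ℂ] W i) i (v ⊗ₜ w)) =
        DirectSum.lof ℂ ι (fun i => V i ⊗[ℂ] W i) i (ρ i g.1 v ⊗ₜ τ i g.2 w) := by
      change DirectSum.lmap _ _ = _
      rw [DirectSum.lmap_lof]
      rfl
    have hR' : Representation.directSum (fun i => extTensor (ρ i) (τ' i)) g
        (DirectSum.lof ℂ ι (fun i => V i ⊗[ℂ] W' i) i (v ⊗ₜ f i w)) =
        DirectSum.lof ℂ ι (fun i => V i ⊗[ℂ] W' i) i (ρ i g.1 v ⊗ₜ τ' i g.2 (f i w)) := by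
      change DirectSum.lmap _ _ = _
      rw [DirectSum.lmap_lof]
      rfl
    refine (congrArg _ hR).trans ((hL _ _).trans (Eq.trans ?_
      (congrArg (Representation.directSum (fun i => extTensor (ρ i) (τ' i)) g) (hL v w)).symm))
    rw [hR']
    congr 2
    exact LinearMap.congr_fun ((f i).isIntertwining' g.2) w

end Congruence

section Inflation

variable {G H A : Type*} [Group G] [Group H] [AddCommGroup A] [Module ℂ A] (φ : G →* H)
  {ρ : Representation ℂ G A} {τ : Representation ℂ H A}

/-- The map from an induced inflated representation to the original one. -/
def indInflHom (hρ : ∀ g, ρ g = τ (φ g)) : Representation.IndV φ ρ →ₗ[ℂ] A :=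
  indVLift φ ρ (fun x => τ x⁻¹) fun g x v => by
    rw [mul_inv_rev, map_mul, hρ, Module.End.mul_apply, Representation.inv_self_apply]

theorem indInflHom_mk (hρ : ∀ g, ρ g = τ (φ g)) (x : H) (v : A) :
    indInflHom φ hρ (Representation.IndV.mk φ ρ x v) = τ x⁻¹ v :=
  indVLift_mk _ _ _ _ _ _

/-- Induction along a surjection inverts inflation. -/
def indInflEquiv (hφ : Function.Surjective φ) (hρ : ∀ g, ρ g = τ (φ g)) :
    (Representation.ind φ ρ).Equiv τ :=
  Representation.Equiv.mk
    (LinearEquiv.ofLinearMap (indInflHom φ hρ) (Representation.IndV.mk φ ρ 1)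
      (LinearMap.ext fun v => by
        refine (indInflHom_mk φ hρ 1 v).trans ?_
        simp)
      (Representation.IndV.hom_ext _ _ fun x => LinearMap.ext fun v => by
        obtain ⟨g, rfl⟩ := hφ x
        change Representation.IndV.mk φ ρ 1 (indInflHom φ hρ
          (Representation.IndV.mk φ ρ (φ g) v)) = Representation.IndV.mk φ ρ (φ g) v
        rw [indInflHom_mk, ← indV_mk_smul φ ρ g 1, mul_one, hρ, Representation.self_inv_apply]))
    fun h => by
      refine Representation.IndV.hom_ext _ _ fun x => LinearMap.ext fun v => ?_
      change indInflHom φ hρ (Representation.ind φ ρ h (Representation.IndV.mk φ ρ x v)) =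
        τ h (indInflHom φ hρ (Representation.IndV.mk φ ρ x v))
      rw [Representation.ind_mk, indInflHom_mk, indInflHom_mk, mul_inv_rev, inv_inv, map_mul]
      rfl

end Inflation

/-- With blocks of size one the action on letters is the action on block numbers, so `wreathAct`
becomes the projection to S_b, which is onto. -/
theorem wreathAct_one {b : ℕ} (w : Wreath 1 b) :
    wreathAct (Equiv.uniqueProd (Fin b) (Fin 1)) w = w.right :=
  Equiv.ext fun i => wreathAct_apply (Equiv.uniqueProd (Fin b) (Fin 1)) w (0, i)

/-- The Foulkes modules for blocks of size one are the Specht modules. -/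
def blockFoulkesOneEquiv {b : ℕ} (ν : Nat.Partition b) :
    (blockFoulkes (Equiv.uniqueProd (Fin b) (Fin 1)) ν).Equiv (specht ν) :=
  indInflEquiv _ (fun σ => ⟨⟨1, σ⟩, wreathAct_one _⟩) fun w => by
    rw [wreathAct_one]
    rfl

end Foulkes

end

theorem corollary1 (a b : ℕ) (ha : 1 ≤ a) :
    Nonempty ((Foulkes.U (Foulkes.add_pred_mul ha b) (Nat.Partition.indiscrete b)).Equiv
      (Representation.directSum fun μ : Nat.Partition b =>
        Foulkes.extTensor (Foulkes.specht μ) (Foulkes.foulkes (a - 1) μ))) ∧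
    Nonempty ((Foulkes.U (two_mul b).symm (Nat.Partition.indiscrete b)).Equiv
      (Representation.directSum fun μ : Nat.Partition b =>
        Foulkes.extTensor (Foulkes.specht μ) (Foulkes.specht μ))) := by
  refine ⟨?_, ⟨(Foulkes.summandEquiv (c := 1) (two_mul b).symm
    (Equiv.uniqueProd (Fin b) (Fin 1))).trans
      (Foulkes.directSumExtTensorCongr _ Foulkes.blockFoulkesOneEquiv)⟩⟩
  cases a with
  | zero => exact absurd ha (by norm_num)
  -- With `blockEquiv c b` as labelling, `wreathAct` unfolds to `wreathHom`, so the block modules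
  -- are the generalized Foulkes modules by definition.
  | succ c => exact ⟨Foulkes.summandEquiv _ (Foulkes.blockEquiv c b)⟩
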